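/- Let $p$ be an odd prime. For $s\ge 0$ let $T_s(z)\in\mathbb Z[z_1,z_2,z_3]$ be the coefficient of $t^{p^s-1}$ in the polynomial $\big((t-z_1)(t-z_2)(t-z_3)\big)^{(p^s-1)/2}$, and let $$\mathfrak D=\{z\in\mathbb Z_p^3 \;:\; |T_1(z)|_p=1\}.$$ For a field $K$ of characteristic $0$ put $W_K=\{(I_1,I_2,I_3)\in K^3 : I_1+I_2+I_3=0\}$ and consider the KZ connection $$\nabla_i=\frac{\partial}{\partial z_i}-H_i(z),\qquad H_i(z)=\frac12\sum_{j\neq i}\frac{\Omega_{ij}}{z_i-z_j},\qquad i=1,2,3,$$ on the trivial bundle with fibre $W_K$, where $\Omega_{ij}$ is the $3\times3$ matrix with entries $-1$ at the places $(i,i),(j,j)$, entries $1$ at the places $(i,j),(j,i)$, and zeros elsewhere. Theorem. (1) For every $s$ the polynomial $T_s$ has no zeros on $\mathfrak D$, and the vectors of rational functions $$\eta_s=\Big(\frac{\partial T_s/\partial z_1}{T_s},\frac{\partial T_s/\partial z_2}{T_s},\frac{\partial T_s/\partial z_3}{T_s}\Big)$$ converge uniformly on $\mathfrak D$ as $s\to\infty$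 to a map $\eta$ which is analytic: for every $a\in\mathfrak D$ it is given on the polydisc $\{z: |z_i-a_i|_p<1,\ i=1,2,3\}$ by a convergent power series centred at $a$. (2) The subspaces $\mathcal L_a\subset\mathbb Q_p^3$ spanned by $\eta(a)$, $a\in\mathfrak D$, are lines in $W_{\mathbb Q_p}$ and form an analytic line subbundle $\mathcal L$ of the trivial bundle $W_{\mathbb Q_p}\times\mathfrak D\to\mathfrak D$; that is, locally on $\mathfrak D$ they are spanned by a nowhere vanishing analytic map to $W_{\mathbb Q_p}$. (3) $\mathcal L$ is invariant under the KZ connection: if $s$ is an analytic section of $\mathcal L$ over an open set $U\subseteq\mathfrak D$, then for $i=1,2,3$ the map $\nabla_i s$, which is defined at the points of $U$ with pairwise distinct coordinates, extends to an analytic section of $\mathcal L$ over all of $U$. (4) In contrast, over $\mathbb C$ the KZ connection on the trivial bundle with fibre $W_{\mathbb C}$ over $\{z\in\mathbb C^3: z_i\ne z_j \text{ for } i\neq j\}$ has no invariant analytic line subbundle (equivalently, since $\dim W_{\mathbb C}=2$, its monodromy representation is irreducible). -/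

import Mathlib

namespace PadicKZ

noncomputable section

/-! The KZ connection in three variables over a field `𝕜`. Points and vectors are indexed
by `Fin 3`, that is, the indices `1, 2, 3` become `0, 1, 2`. -/

/-- The space `W` of vectors with zero coordinate sum. -/
def W (𝕜 : Type*) [Field 𝕜] : Submodule 𝕜 (Fin 3 → 𝕜) where
  carrier := {v | ∑ i, v i = 0}
  zero_mem' := by simp
  add_mem' := by
    intro v w hv hw
    simp only [Set.mem_ofPred_eq] at hv hw ⊢
    simp [Finset.sum_add_distrib, hv, hw]
  smul_mem' := by
    intro c v hv
    simp only [Set.mem_ofPred_eq] at hv ⊢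
    simp [← Finset.mul_sum, hv]

/-- The matrix `Ω_{ij}`, for `i ≠ j`: it has `-1` at the places `(i,i)` and `(j,j)`, `1` at the
places `(i,j)` and `(j,i)`, and zeros elsewhere. -/
def Omega (𝕜 : Type*) [Field 𝕜] (i j : Fin 3) : Matrix (Fin 3) (Fin 3) 𝕜 :=
  Matrix.single i j 1 + Matrix.single j i 1 - Matrix.single i i 1 - Matrix.single j j 1

/-- `H_i(z) = (1/2) ∑_{j ≠ i} Ω_{ij} / (z_i - z_j)`. -/
def H {𝕜 : Type*} [Field 𝕜] (i : Fin 3) (z : Fin 3 → 𝕜) : Matrix (Fin 3) (Fin 3) 𝕜 :=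
  (2 : 𝕜)⁻¹ • ∑ j ∈ Finset.univ.erase i, (z i - z j)⁻¹ • Omega 𝕜 i j

/-- The points with pairwise distinct coordinates, where the matrices `H_i` are regular. -/
def offDiagonals (𝕜 : Type*) : Set (Fin 3 → 𝕜) :=
  {z | Function.Injective z}

/-- The KZ operator `∇_i = ∂/∂z_i - H_i(z)` on vector-valued functions. -/
def nabla {𝕜 : Type*} [NontriviallyNormedField 𝕜] (i : Fin 3)
    (s : (Fin 3 → 𝕜) → (Fin 3 → 𝕜)) (z : Fin 3 → 𝕜) : Fin 3 → 𝕜 :=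
  fderiv 𝕜 s z (Pi.single i 1) - Matrix.mulVec (H i z) (s z)

/-- A family of lines `L_z ⊆ W`, `z ∈ D`, is an analytic line subbundle of the trivial bundle
`W × D → D` if locally on `D` it is spanned by a nowhere vanishing analytic map to `W`. -/
def IsAnalyticLineSubbundle {𝕜 : Type*} [NontriviallyNormedField 𝕜]
    (D : Set (Fin 3 → 𝕜)) (L : (Fin 3 → 𝕜) → Submodule 𝕜 (Fin 3 → 𝕜)) : Prop :=
  ∀ a ∈ D, ∃ U : Set (Fin 3 → 𝕜), IsOpen U ∧ a ∈ U ∧ U ⊆ D ∧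
    ∃ e : (Fin 3 → 𝕜) → (Fin 3 → 𝕜), AnalyticOnNhd 𝕜 e U ∧
      ∀ z ∈ U, e z ∈ W 𝕜 ∧ e z ≠ 0 ∧ L z = Submodule.span 𝕜 {e z}

/-- `s` is an analytic section over `U` of the family of subspaces `L`. -/
def IsAnalyticSection {𝕜 : Type*} [NontriviallyNormedField 𝕜]
    (L : (Fin 3 → 𝕜) → Submodule 𝕜 (Fin 3 → 𝕜)) (U : Set (Fin 3 → 𝕜))
    (s : (Fin 3 → 𝕜) → (Fin 3 → 𝕜)) : Prop :=
  AnalyticOnNhd 𝕜 s U ∧ ∀ z ∈ U, s z ∈ L z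

/-- Invariance under the KZ connection: if `s` is an analytic section of `L` over an open
`U ⊆ D`, then so are the `∇_i s`. Since `H_i` has poles on the diagonals `z_i = z_j`, for a set `U`
that meets them this says that `∇_i s`, defined off the diagonals, extends to an analytic section
of `L` over all of `U`. -/
def IsKZInvariant {𝕜 : Type*} [NontriviallyNormedField 𝕜]
    (D : Set (Fin 3 → 𝕜)) (L : (Fin 3 → 𝕜) → Submodule 𝕜 (Fin 3 → 𝕜)) : Prop :=
  ∀ U : Set (Fin 3 → 𝕜), IsOpen U → U ⊆ D →
    ∀ s : (Fin 3 → 𝕜) → (Fin 3 → 𝕜), IsAnalyticSection L U s →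
      ∀ i : Fin 3, ∃ s' : (Fin 3 → 𝕜) → (Fin 3 → 𝕜), IsAnalyticSection L U s' ∧
        ∀ z ∈ U ∩ offDiagonals 𝕜, s' z = nabla i s z

/-! The `p^s`-approximation polynomials and the line bundle. -/

/-- The master polynomial `((t - z_1)(t - z_2)(t - z_3))^((p^s - 1)/2)`, a polynomial in `t`
whose coefficients are polynomials in `z_1, z_2, z_3`. -/
def master (p s : ℕ) : Polynomial (MvPolynomial (Fin 3) ℤ) :=
  (∏ i : Fin 3, (Polynomial.X - Polynomial.C (MvPolynomial.X i))) ^ ((p ^ s - 1) / 2)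

/-- `T_s(z)`, the coefficient of `t^(p^s - 1)` in the master polynomial; `T_0 = 1`. -/
def T (p s : ℕ) : MvPolynomial (Fin 3) ℤ :=
  (master p s).coeff (p ^ s - 1)

/-- The domain of the points `z` of `ℤ_p^3`, regarded as a subset of `ℚ_p^3`, with
`|T_1(z)|_p = 1`. -/
def domain (p : ℕ) [Fact p.Prime] : Set (Fin 3 → ℚ_[p]) :=
  {z | (∀ i, ‖z i‖ ≤ 1) ∧ ‖MvPolynomial.aeval z (T p 1)‖ = 1}

/-- The vector of rational functions `η_s^{(i)} = (∂T_s/∂z_i) / T_s`, `i = 1, 2, 3`. -/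
def etaApprox (p : ℕ) [Fact p.Prime] (s : ℕ) (z : Fin 3 → ℚ_[p]) : Fin 3 → ℚ_[p] :=
  fun i => MvPolynomial.aeval z (MvPolynomial.pderiv i (T p s)) / MvPolynomial.aeval z (T p s)

/-- The vector `η(z) = lim_{s → ∞} η_s(z)`. -/
def eta (p : ℕ) [Fact p.Prime] (z : Fin 3 → ℚ_[p]) : Fin 3 → ℚ_[p] :=
  Filter.limUnder Filter.atTop (fun s : ℕ => etaApprox p s z)

/-- The subspace `L_a` generated by `η(a)`. -/
def lineL (p : ℕ) [Fact p.Prime] (a : Fin 3 → ℚ_[p]) : Submodule ℚ_[p] (Fin 3 → ℚ_[p]) :=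
  Submodule.span ℚ_[p] {eta p a}

end

end PadicKZ

/-! The p-adic half rests on Dwork congruences. Let σ be the Frobenius lift `z_i ↦ z_i^p`, `t ↦
t^p`. The master polynomial of level s is the product of the `f^(p^j)`, j < s, with f that of level
1, and `f^(p^(j+1)) ≡ σ(f^(p^j))` modulo `p^(j+1)`. Expanding the product in these differences
(`prod_eq_sum_ghost`) and taking one coefficient, which a degree bound makes multiplicative
(`coeff_mul_frobPoly_pow`), gives `T_n = ∑ C_k σ^(k+1)(T_(n-k-1))` with `p^k ∣ C_k`. Hence, after
clearing denominators, `T_(n+2)/T_(n+1) ≡ σ(T_(n+1)/T_n)` modulo `p^(n+1)` (`T_dwork`). Since `∂_i ∘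
σ` carries a factor p, differentiation shows inductively that the logarithmic derivatives of `T_s`
and `T_(s+1)` agree modulo `p^s`. On the domain every `T_s` is a unit, so `η_s` converges. The same
congruences in `ℤ_p[[x]]` present η as a power series with integral coefficients, convergent on the
open unit polydisc.

Put `N = (p^s-1)/2`, which tends to -1/2. Translation invariance, homogeneity and an Euler–Darboux
equation of the master polynomial pass to `T_s`, the first only modulo `p^s`. In the limit they give
`∑ η_i = 0`, `∑ z_i η_i = -1/2` (so η never vanishes) and `∇_i η = -η_i η` (`nabla_eta`), which is
invariance.

Over ℂ an invariant line bundle, restricted to the points (0, 1, y), would have flat sections with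
scalar holonomy around 0, 1 and ∞. Each residue there is a scalar α plus an integer multiple of a
projection, so the holonomy on any invariant line is `exp(2πiα)` (`holonomy_eq`). This is 1 at 0 and
at 1 but -1 on large circles, although the holonomies around 0 and 1 multiply to the one on a large
circle. -/

namespace PadicKZ

open Finset

/-! ### Expansion of a product in Frobenius differences. -/

section GhostExpansion

variable {B : Type*} [CommRing B] (σ : B →+* B) (y : ℕ → B)

/-- The part of the expansion of `y 0 * ⋯ * y (n - 1)` in the differences `y (j + 1) - σ (y j)`
and their images under the powers of `σ` that collects the terms which do not split at any of the
places `1, …, k`. -/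
def ghost : ℕ → ℕ → B
  | 0, _ => 1
  -- Telescoping writes `y n` as the sum over m < n of `σ^m (y (n-m) - σ (y (n-m-1)))`, plus `σ^n (y
  -- 0)`; the m-th term joins the places m+1, …, n. Terms with m ≥ k add up to `σ^k (y (n-k))`,
  -- while for m < k only the places 1, …, m remain to be joined. The end of the product always
  -- counts as a split, whence the value 0.
  | n + 1, k => if n + 1 ≤ k then 0 else
      ghost n k * (σ ^ k) (y (n - k)) +
        ∑ m ∈ range k, ghost n m * (σ ^ m) (y (n - m) - σ (y (n - m - 1)))

theorem ghost_self {n : ℕ} (hn : 0 < n) : ghost σ y n n = 0 := by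
  obtain ⟨n, rfl⟩ := Nat.exists_eq_succ_of_ne_zero hn.ne'
  simp [ghost]

theorem ghost_zero_right (n : ℕ) : ghost σ y n 0 = ∏ j ∈ range n, y j := by
  induction n with
  | zero => simp [ghost]
  | succ n ih => simp [ghost, ih, prod_range_succ]

/-- The difference collects the terms whose first split is at k+1; to the right of it the expansion
is unrestricted and sums back to a full product. -/
theorem ghost_sub_ghost {n k : ℕ} (hk : k < n) :
    ghost σ y n k - ghost σ y n (k + 1) =
      ghost σ y (k + 1) k * (σ ^ (k + 1)) (∏ j ∈ range (n - (k + 1)), y j) := by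
  induction n with
  | zero => omega
  | succ n ih =>
    rcases Nat.lt_succ_iff_lt_or_eq.mp hk with h | rfl
    · have e1 : ghost σ y (n + 1) k = ghost σ y n k * (σ ^ k) (y (n - k)) +
          ∑ m ∈ range k, ghost σ y n m * (σ ^ m) (y (n - m) - σ (y (n - m - 1))) := by
        rw [ghost, if_neg (by omega)]
      have e2 : ghost σ y (n + 1) (k + 1) =
          ghost σ y n (k + 1) * (σ ^ (k + 1)) (y (n - (k + 1))) +
          ∑ m ∈ range (k + 1), ghost σ y n m * (σ ^ m) (y (n - m) - σ (y (n - m - 1))) := by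
        rw [ghost, if_neg (by omega)]
      have e3 : (σ ^ (k + 1)) (y (n - (k + 1))) = (σ ^ k) (σ (y (n - k - 1))) := by
        rw [pow_succ, RingHom.mul_def, RingHom.comp_apply, Nat.sub_sub]
      have e4 : n + 1 - (k + 1) = n - (k + 1) + 1 := by omega
      have ih := ih h
      rw [e1, e2, sum_range_succ, e4, prod_range_succ, map_mul, ← mul_assoc, ← ih, e3, map_sub]
      ring
    · rw [ghost_self σ y (Nat.succ_pos _)]
      simp

theorem prod_eq_sum_ghost {n : ℕ} (hn : 0 < n) :
    ∏ j ∈ range n, y j = ∑ k ∈ range n,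
      ghost σ y (k + 1) k * (σ ^ (k + 1)) (∏ j ∈ range (n - (k + 1)), y j) := by
  rw [← ghost_zero_right σ y n,
    ← sum_congr rfl fun k hk => ghost_sub_ghost σ y (mem_range.mp hk),
    sum_range_sub', ghost_self σ y hn, sub_zero]

/-- Joining d+1 consecutive places costs a difference divisible by `p^(d+1)`, so k joined places
force `p^k`. -/
theorem pow_dvd_ghost {p : ℕ} (h : ∀ j, (p : B) ^ (j + 1) ∣ y (j + 1) - σ (y j)) {n : ℕ}
    (hn : 0 < n) (k : ℕ) : (p : B) ^ k ∣ ghost σ y n k := by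
  induction n generalizing k with
  | zero => omega
  | succ n ih =>
    rcases Nat.eq_zero_or_pos k with rfl | hk
    · simp
    · rw [ghost]
      split_ifs with hnk
      · simp
      · have ih := ih (by omega)
        refine dvd_add (dvd_mul_of_dvd_left (ih k) _) (dvd_sum fun m hm => ?_)
        have hm := mem_range.mp hm
        obtain ⟨d, hd⟩ : ∃ d, n - m = d + 1 := ⟨n - m - 1, by omega⟩
        have h1 : (p : B) ^ (d + 1) ∣ (σ ^ m) (y (n - m) - σ (y (n - m - 1))) := by
          rw [hd, Nat.add_sub_cancel]
          have h2 := map_dvd (σ ^ m) (h d)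
          rwa [map_pow, map_natCast] at h2
        refine (pow_dvd_pow (p : B) (show k ≤ m + (d + 1) by omega)).trans ?_
        rw [pow_add]
        exact mul_dvd_mul (ih m) h1

end GhostExpansion

/-! ### Dwork congruences and their logarithmic derivatives. -/

section DworkCongruence

variable {A : Type*} [CommRing A] (σ : A →+* A) {p : ℕ}

/-- Dwork congruences for a sequence with a `σ`-linear recursion whose coefficients are
increasingly divisible by `p`. -/
theorem dwork_congruence (T C : ℕ → A) (hT0 : T 0 = 1)
    (hT : ∀ n, 0 < n → T n = ∑ k ∈ range n, C k * (σ ^ (k + 1)) (T (n - (k + 1))))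
    (hC : ∀ k, (p : A) ^ k ∣ C k) (a m : ℕ) :
    (p : A) ^ (m + 1) ∣ T (m + a + 1) * (σ ^ a) (T m) - T (m + a) * (σ ^ a) (T (m + 1)) := by
  induction hN : m + a using Nat.strong_induction_on generalizing a m with
  | _ N ih =>
  subst hN
  rcases Nat.eq_zero_or_pos a with rfl | ha
  · have : T (m + 0 + 1) * (σ ^ 0) (T m) - T (m + 0) * (σ ^ 0) (T (m + 1)) = 0 := by
      simp [mul_comm]
    rw [this]
    exact dvd_zero _
  have split (u v w : ℕ) : (σ ^ (u + v)) (T w) = (σ ^ u) ((σ ^ v) (T w)) := by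
    rw [pow_add, RingHom.mul_def, RingHom.comp_apply]
  -- Both leading terms are expanded by the recursion. The longer one has the extra summand k = m +
  -- a, which is harmless because a ≥ 1 makes its coefficient divisible by `p^(m+1)`.
  have key : T (m + a + 1) * (σ ^ a) (T m) - T (m + a) * (σ ^ a) (T (m + 1)) =
      (∑ k ∈ range (m + a), C k *
        ((σ ^ (k + 1)) (T (m + a + 1 - (k + 1))) * (σ ^ a) (T m) -
          (σ ^ (k + 1)) (T (m + a - (k + 1))) * (σ ^ a) (T (m + 1)))) +
        C (m + a) * (σ ^ a) (T m) := by
    rw [hT (m + a + 1) (by omega), hT (m + a) (by omega), sum_range_succ, Nat.sub_self, hT0, map_one,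
      mul_one, add_mul, sum_mul, sum_mul, add_sub_right_comm, ← sum_sub_distrib]
    congr 1
    refine sum_congr rfl fun k _ => ?_
    ring
  rw [key]
  refine dvd_add (dvd_sum fun k hk => ?_)
    (dvd_mul_of_dvd_left ((pow_dvd_pow _ (by omega)).trans (hC _)) _)
  have hk := mem_range.mp hk
  rcases Nat.lt_or_ge k a with hka | hka
  -- Here the summand is `σ^(k+1)` of the congruence with the same m and smaller shift b.
  · obtain ⟨b, rfl⟩ : ∃ b, a = k + 1 + b := ⟨a - (k + 1), by omega⟩
    have h1 := map_dvd (σ ^ (k + 1)) (ih (m + b) (by omega) b m rfl)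
    refine dvd_mul_of_dvd_right ?_ _
    have e1 : m + (k + 1 + b) + 1 - (k + 1) = m + b + 1 := by omega
    have e2 : m + (k + 1 + b) - (k + 1) = m + b := by omega
    rw [map_pow, map_natCast] at h1
    rw [e1, e2, split (k + 1) b m, split (k + 1) b (m + 1), ← map_mul, ← map_mul, ← map_sub]
    exact h1
  -- Here the summand is, up to sign, `σ^a` of the congruence for (b, m'). The power `p^(m'+1)` is
  -- weaker, but `p^k ∣ C k` compensates: k + m' + 1 = m + a.
  · obtain ⟨b, hb⟩ : ∃ b, k + 1 = a + b := ⟨k + 1 - a, by omega⟩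
    obtain ⟨m', rfl⟩ : ∃ m', m = m' + b := ⟨m - b, by omega⟩
    have h1 := map_dvd (σ ^ a) (ih (m' + b) (by omega) b m' rfl)
    have e1 : m' + b + a + 1 - (k + 1) = m' + 1 := by omega
    have e2 : m' + b + a - (k + 1) = m' := by omega
    rw [e1, e2, hb, split a b (m' + 1), split a b m']
    have h2 := mul_dvd_mul (hC k) (dvd_neg.mpr h1)
    rw [map_pow, map_natCast, ← pow_add] at h2
    refine (pow_dvd_pow (p : A) (show m' + b + 1 ≤ k + (m' + 1) by omega)).trans ?_
    convert h2 using 1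
    simp only [map_sub, map_mul]
    ring

/-- Congruences for logarithmic derivatives that follow from the Dwork congruences. -/
theorem logDeriv_congruence [IsDomain A] (hp : Prime (p : A)) (T : ℕ → A)
    (hT : ∀ n, (p : A) ^ (n + 1) ∣ T (n + 2) * σ (T n) - T (n + 1) * σ (T (n + 1)))
    (hTp : ∀ n, ¬ (p : A) ∣ σ (T n)) (D : Derivation ℤ A A) (ζ : A)
    (hD : ∀ f, D (σ f) = p * ζ * σ (D f)) (n : ℕ) :
    (p : A) ^ n ∣ T n * D (T (n + 1)) - T (n + 1) * D (T n) := by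
  induction n with
  | zero => simp
  | succ n ih =>
    obtain ⟨X, hX⟩ := hT n
    obtain ⟨Y, hY⟩ := map_dvd σ ih
    -- The factor p in `hD` raises the inductive power n to n+1. Clearing the denominators of the
    -- logarithmic derivatives costs two factors `σ (T n)`, cancelled because the prime p does not
    -- divide them.
    have hDX := congrArg D hX
    have hpD : D ((p : A) ^ (n + 1)) = 0 := by
      rw [← Nat.cast_pow]; exact D.map_natCast _
    simp only [map_sub, Derivation.leibniz, hD, smul_eq_mul, hpD, mul_zero, add_zero] at hDX
    rw [map_pow, map_natCast] at hY
    simp only [map_sub, map_mul] at hY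
    refine hp.pow_dvd_of_dvd_mul_left (n + 1) (hTp n)
      (hp.pow_dvd_of_dvd_mul_left (n + 1) (hTp n) ?_)
    refine ⟨T (n + 1) * σ (T n) * D X - D (T (n + 1)) * X * σ (T n)
      - p * ζ * T (n + 1) * X * σ (D (T n)) + ζ * T (n + 1) ^ 2 * Y, ?_⟩
    linear_combination (T (n + 1) * σ (T n)) * hDX - (D (T (n + 1)) * σ (T n)) * hX
      - p * ζ * T (n + 1) * σ (D (T n)) * hX + p * ζ * T (n + 1) ^ 2 * hY

end DworkCongruence

/-! ### The Frobenius lift on polynomials. -/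

section Frobenius

open Polynomial

/-- The lift of Frobenius `z_i ↦ z_i ^ p` on `ℤ[z_1, z_2, z_3]`. -/
noncomputable def frob (p : ℕ) : MvPolynomial (Fin 3) ℤ →+* MvPolynomial (Fin 3) ℤ :=
  (MvPolynomial.expand p : MvPolynomial (Fin 3) ℤ →ₐ[ℤ] _).toRingHom

/-- The lift of Frobenius `z_i ↦ z_i ^ p`, `t ↦ t ^ p` on `ℤ[z_1, z_2, z_3][t]`. -/
noncomputable def frobPoly (p : ℕ) :
    (MvPolynomial (Fin 3) ℤ)[X] →+* (MvPolynomial (Fin 3) ℤ)[X] :=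
  (expand (MvPolynomial (Fin 3) ℤ) p).toRingHom.comp (mapRingHom (frob p))

@[simp] theorem frob_X (p : ℕ) (i : Fin 3) :
    frob p (MvPolynomial.X i) = MvPolynomial.X i ^ p := MvPolynomial.expand_X p i

@[simp] theorem frobPoly_X (p : ℕ) : frobPoly p X = X ^ p := by simp [frobPoly]

@[simp] theorem frobPoly_C (p : ℕ) (a : MvPolynomial (Fin 3) ℤ) :
    frobPoly p (C a) = C (frob p a) := by simp [frobPoly]

variable {p : ℕ}

theorem coeff_frobPoly_pow (hp : 0 < p) (k : ℕ) (f : (MvPolynomial (Fin 3) ℤ)[X]) (n : ℕ) :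
    ((frobPoly p ^ k) f).coeff n =
      if p ^ k ∣ n then (frob p ^ k) (f.coeff (n / p ^ k)) else 0 := by
  induction k generalizing n with
  | zero => simp
  | succ k ih =>
    rw [pow_succ', RingHom.mul_def, RingHom.comp_apply, pow_succ' (frob p), RingHom.mul_def,
      RingHom.comp_apply]
    change (expand _ p (map (frob p) ((frobPoly p ^ k) f))).coeff n = _
    rw [coeff_expand hp, coeff_map, ih]
    by_cases h1 : p ∣ n
    · obtain ⟨m, rfl⟩ := h1
      rw [if_pos (dvd_mul_right _ _), Nat.mul_div_cancel_left _ hp, pow_succ',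
        Nat.mul_div_mul_left _ _ hp]
      simp only [Nat.mul_dvd_mul_iff_left hp]
      split_ifs <;> simp
    · rw [if_neg h1, if_neg fun h => h1 ((dvd_pow_self p k.succ_ne_zero).trans h)]

theorem natDegree_frobPoly_pow_le (hp : 0 < p) (k : ℕ) (f : (MvPolynomial (Fin 3) ℤ)[X]) :
    ((frobPoly p ^ k) f).natDegree ≤ p ^ k * f.natDegree := by
  refine natDegree_le_iff_coeff_eq_zero.mpr fun n hn => ?_
  rw [coeff_frobPoly_pow hp]
  split_ifs with h
  · obtain ⟨m, rfl⟩ := h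
    rw [Nat.mul_div_cancel_left _ (pow_pos hp k),
      coeff_eq_zero_of_natDegree_lt (lt_of_mul_lt_mul_left' hn), map_zero]
  · rfl

/-- The second factor lives in degrees divisible by `p^k`, so the first contributes only degrees
congruent to -1 modulo `p^k`. The bound `2 * (p^k - 1)` excludes the second such degree, `2 * p^k -
1`, leaving a single product. -/
theorem coeff_mul_frobPoly_pow (hp : 0 < p) {k n : ℕ} (hkn : k ≤ n)
    {f : (MvPolynomial (Fin 3) ℤ)[X]} (hf : f.natDegree ≤ 2 * (p ^ k - 1))
    (g : (MvPolynomial (Fin 3) ℤ)[X]) :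
    (f * (frobPoly p ^ k) g).coeff (p ^ n - 1) =
      f.coeff (p ^ k - 1) * (frob p ^ k) (g.coeff (p ^ (n - k) - 1)) := by
  obtain ⟨d, rfl⟩ := Nat.exists_eq_add_of_le hkn
  have hk : 0 < p ^ k := pow_pos hp k
  have hd : 0 < p ^ d := pow_pos hp d
  have e : p ^ (k + d) - 1 = (p ^ k - 1) + p ^ k * (p ^ d - 1) := by
    rw [pow_add, Nat.mul_sub, mul_one]
    have := Nat.le_mul_of_pos_right (p ^ k) hd
    omega
  rw [coeff_mul, sum_eq_single (p ^ k - 1, p ^ k * (p ^ d - 1)), coeff_frobPoly_pow hp,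
    if_pos (dvd_mul_right _ _), Nat.mul_div_cancel_left _ hk, Nat.add_sub_cancel_left]
  · rintro ⟨i, j⟩ hij hne
    rw [HasAntidiagonal.mem_antidiagonal, e] at hij
    rw [coeff_frobPoly_pow hp]
    split_ifs with h
    · obtain ⟨m, rfl⟩ := h
      rw [coeff_eq_zero_of_natDegree_lt, zero_mul]
      refine hf.trans_lt ?_
      by_contra hi
      have hm : m = p ^ d - 1 := by
        rcases Nat.lt_trichotomy m (p ^ d - 1) with h | h | h
        · have := Nat.mul_le_mul_left (p ^ k) (Nat.succ_le_of_lt h)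
          rw [Nat.succ_eq_add_one, mul_add] at this
          dsimp only at hij
          omega
        · exact h
        · have := Nat.mul_le_mul_left (p ^ k) (Nat.succ_le_of_lt h)
          rw [Nat.succ_eq_add_one, mul_add] at this
          dsimp only at hij
          omega
      subst hm
      apply hne
      dsimp only at hij
      rw [show i = p ^ k - 1 by omega]
    · simp
  · intro h
    exact absurd (HasAntidiagonal.mem_antidiagonal.mpr e.symm) h

theorem pow_dvd_coeff_of_natCast_pow_dvd {k : ℕ} {f : (MvPolynomial (Fin 3) ℤ)[X]}
    (h : (p : (MvPolynomial (Fin 3) ℤ)[X]) ^ k ∣ f) (n : ℕ) :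
    (p : MvPolynomial (Fin 3) ℤ) ^ k ∣ f.coeff n := by
  obtain ⟨g, rfl⟩ := h
  refine ⟨g.coeff n, ?_⟩
  rw [← Nat.cast_pow, ← Nat.cast_pow, ← C_eq_natCast, coeff_C_mul]

theorem natCast_dvd_frob_sub_pow (hp : p.Prime) (f : MvPolynomial (Fin 3) ℤ) :
    (p : MvPolynomial (Fin 3) ℤ) ∣ frob p f - f ^ p := by
  induction f using MvPolynomial.induction_on with
  | C a =>
    have : frob p (MvPolynomial.C a) = MvPolynomial.C a := MvPolynomial.expand_C p a
    rw [this, ← map_pow, ← map_sub, ← map_natCast (MvPolynomial.C : ℤ →+* MvPolynomial (Fin 3) ℤ)]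
    refine map_dvd _ ?_
    have := Fact.mk hp
    rw [← ZMod.intCast_eq_intCast_iff_dvd_sub]
    simp
  | add f g hf hg =>
    obtain ⟨r, hr⟩ := exists_add_pow_prime_eq hp f g
    rw [hr, map_add]
    have : frob p f + frob p g - (f ^ p + g ^ p + p * f * g * r) =
      (frob p f - f ^ p) + (frob p g - g ^ p) - p * (f * g * r) := by ring
    rw [this]
    exact dvd_sub (dvd_add hf hg) (dvd_mul_right _ _)
  | mul_X f i hf =>
    rw [map_mul, frob_X, mul_pow, ← sub_mul]
    exact dvd_mul_of_dvd_left hf _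

theorem natCast_dvd_frob_pow_sub_pow (hp : p.Prime) (f : MvPolynomial (Fin 3) ℤ) (a : ℕ) :
    (p : MvPolynomial (Fin 3) ℤ) ∣ (frob p ^ a) f - f ^ p ^ a := by
  induction a with
  | zero => simp
  | succ a ih =>
    rw [pow_succ', RingHom.mul_def, RingHom.comp_apply]
    have h1 := map_dvd (frob p) ih
    rw [map_natCast, map_sub, map_pow] at h1
    have h2 := (natCast_dvd_frob_sub_pow hp f).trans (sub_dvd_pow_sub_pow (frob p f) (f ^ p) (p ^ a))
    rw [← pow_mul, ← pow_succ'] at h2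
    simpa using dvd_add h1 h2

theorem pderiv_frob (i : Fin 3) (f : MvPolynomial (Fin 3) ℤ) :
    MvPolynomial.pderiv i (frob p f) =
      (p : MvPolynomial (Fin 3) ℤ) * MvPolynomial.X i ^ (p - 1) * frob p (MvPolynomial.pderiv i f) := by
  induction f using MvPolynomial.induction_on with
  | C a =>
    have : frob p (MvPolynomial.C a) = MvPolynomial.C a := MvPolynomial.expand_C p a
    rw [this]; simp
  | add f g hf hg => simp only [map_add, hf, hg, mul_add]
  | mul_X f j hf =>
    rw [map_mul, frob_X, MvPolynomial.pderiv_mul, hf, MvPolynomial.pderiv_pow,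
      MvPolynomial.pderiv_mul, map_add, map_mul, map_mul, frob_X]
    rcases eq_or_ne j i with rfl | h
    · simp; ring
    · rw [MvPolynomial.pderiv_X_of_ne h]; simp; ring

end Frobenius

/-! ### Congruences for the polynomials `T_s`. -/

section TCongruences

open Polynomial

variable {p : ℕ}

theorem natCast_dvd_master_pow_sub (hp : p.Prime) (s : ℕ) :
    (p : (MvPolynomial (Fin 3) ℤ)[X]) ∣ master p s ^ p - frobPoly p (master p s) := by
  have h0 : (p : (MvPolynomial (Fin 3) ℤ)[X]) ∣
      (∏ i : Fin 3, (X - C (MvPolynomial.X i))) ^ p -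
        frobPoly p (∏ i : Fin 3, (X - C (MvPolynomial.X i))) := by
    have hlin (i : Fin 3) : (p : (MvPolynomial (Fin 3) ℤ)[X]) ∣
        (X - C (MvPolynomial.X i)) ^ p - frobPoly p (X - C (MvPolynomial.X i)) := by
      obtain ⟨r, hr⟩ := exists_add_pow_prime_eq hp
        ((X : (MvPolynomial (Fin 3) ℤ)[X]) - C (MvPolynomial.X i)) (C (MvPolynomial.X i))
      rw [sub_add_cancel] at hr
      refine ⟨-((X - C (MvPolynomial.X i)) * C (MvPolynomial.X i) * r), ?_⟩
      rw [map_sub, frobPoly_X, frobPoly_C, frob_X, hr, map_pow]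
      ring
    rw [← prod_pow, map_prod]
    simp only [Fin.prod_univ_three]
    have h01 := hlin 0
    have h11 := hlin 1
    have h21 := hlin 2
    have mulsub {a b c d : (MvPolynomial (Fin 3) ℤ)[X]} (h1 : (p : (MvPolynomial (Fin 3) ℤ)[X]) ∣ a - b)
        (h2 : (p : (MvPolynomial (Fin 3) ℤ)[X]) ∣ c - d) :
        (p : (MvPolynomial (Fin 3) ℤ)[X]) ∣ a * c - b * d := by
      have : a * c - b * d = (a - b) * c + b * (c - d) := by ring
      rw [this]
      exact dvd_add (dvd_mul_of_dvd_left h1 _) (dvd_mul_of_dvd_right h2 _)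
    exact mulsub (mulsub h01 h11) h21
  have h1 := h0.trans (sub_dvd_pow_sub_pow _ _ ((p ^ s - 1) / 2))
  rwa [pow_right_comm, ← map_pow] at h1

/-- The exponent is (p-1)/2 times the geometric sum 1 + p + ⋯ + p^(s-1). -/
theorem master_eq_prod (hp : p.Prime) (hp2 : p ≠ 2) (s : ℕ) :
    master p s = ∏ j ∈ range s, master p 1 ^ p ^ j := by
  have hodd : Odd p := hp.odd_of_ne_two hp2
  simp only [master]
  rw [prod_pow_eq_pow_sum, ← pow_mul]
  congr 1
  obtain ⟨m, hm⟩ := hodd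
  have h1 : (p ^ 1 - 1) / 2 = m := by rw [pow_one]; omega
  rw [h1]
  have h2 : p ^ s = 2 * (m * ∑ j ∈ range s, p ^ j) + 1 := by
    have h4 : (∑ j ∈ range s, p ^ j) * (p - 1) = p ^ s - 1 := by
      have := geom_sum_mul_of_one_le hp.one_lt.le s
      simpa using this
    have h5 : p - 1 = 2 * m := by omega
    rw [h5] at h4
    have h6 : 0 < p ^ s := pow_pos hp.pos s
    have h7 : 2 * (m * ∑ j ∈ range s, p ^ j) = (∑ j ∈ range s, p ^ j) * (2 * m) := by ring
    omega
  omega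

theorem natDegree_master_one_le (hp2 : Odd p) : (master p 1).natDegree ≤ 2 * (p - 1) := by
  rw [master]
  refine natDegree_pow_le.trans ?_
  have h3 : (∏ i : Fin 3, (X - C (MvPolynomial.X i : MvPolynomial (Fin 3) ℤ))).natDegree = 3 := by
    rw [natDegree_prod_of_monic _ _ fun i _ => monic_X_sub_C _]
    simp
  obtain ⟨m, rfl⟩ := hp2
  rw [h3, pow_one]
  omega

/-- The j-th factor or difference has degree at most `2 * (p-1) * p^j`, since σ multiplies degrees
by at most p; the geometric sum gives the bound needed to extract coefficients. -/
theorem natDegree_ghost_le (hp : 0 < p) {f : (MvPolynomial (Fin 3) ℤ)[X]}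
    (hf : f.natDegree ≤ 2 * (p - 1)) (n k : ℕ) :
    (ghost (frobPoly p) (fun j => f ^ p ^ j) n k).natDegree ≤ 2 * (p ^ n - 1) := by
  induction n generalizing k with
  | zero => simp [ghost]
  | succ n ih =>
    rw [ghost]
    split_ifs with hk
    · simp
    have hy (m : ℕ) (hm : m ≤ n) :
        ((frobPoly p ^ m) (f ^ p ^ (n - m))).natDegree ≤ p ^ n * (2 * (p - 1)) := by
      refine (natDegree_frobPoly_pow_le hp m _).trans ?_
      obtain ⟨d, rfl⟩ := Nat.exists_eq_add_of_le hm
      rw [Nat.add_sub_cancel_left, pow_add, mul_assoc]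
      exact Nat.mul_le_mul_left _ (natDegree_pow_le.trans (Nat.mul_le_mul_left _ hf))
    have htot : 2 * (p ^ n - 1) + p ^ n * (2 * (p - 1)) ≤ 2 * (p ^ (n + 1) - 1) := by
      have h1 : 0 < p ^ n := pow_pos hp n
      have h2 : p ^ (n + 1) = p ^ n + p ^ n * (p - 1) := by
        obtain ⟨q, rfl⟩ : ∃ q, p = q + 1 := ⟨p - 1, by omega⟩
        rw [Nat.add_sub_cancel]; ring
      have h3 : p ^ n * (2 * (p - 1)) = 2 * (p ^ n * (p - 1)) := by ring
      omega
    refine natDegree_add_le_of_degree_le ?_ (natDegree_sum_le_of_forall_le _ _ fun m hm => ?_)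
    · exact (natDegree_mul_le_of_le (ih k) (hy k (by omega))).trans htot
    · have hm := mem_range.mp hm
      refine (natDegree_mul_le_of_le (ih m) ?_).trans htot
      rw [map_sub]
      refine (natDegree_sub_le _ _).trans (max_le (hy m (by omega)) ?_)
      have : (frobPoly p ^ m) (frobPoly p (f ^ p ^ (n - m - 1))) =
          (frobPoly p ^ (m + 1)) (f ^ p ^ (n - (m + 1))) := by
        rw [pow_succ, RingHom.mul_def, RingHom.comp_apply, Nat.sub_sub]
      rw [this]
      exact hy (m + 1) (by omega)

theorem T_zero : T p 0 = 1 := by simp [T, master]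

/-- The Dwork congruences for the polynomials `T_s`. -/
theorem T_dwork (hp : p.Prime) (hp2 : p ≠ 2) (a m : ℕ) :
    (p : MvPolynomial (Fin 3) ℤ) ^ (m + 1) ∣
      T p (m + a + 1) * (frob p ^ a) (T p m) - T p (m + a) * (frob p ^ a) (T p (m + 1)) := by
  have hdeg := natDegree_ghost_le hp.pos (natDegree_master_one_le (hp.odd_of_ne_two hp2))
  refine dwork_congruence (frob p) (T p)
    (fun k => (ghost (frobPoly p) (fun j => master p 1 ^ p ^ j) (k + 1) k).coeff (p ^ (k + 1) - 1))
    T_zero (fun n hn => ?_) (fun k => ?_) a m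
  · rw [T, master_eq_prod hp hp2 n, prod_eq_sum_ghost (frobPoly p) _ hn, finsetSum_coeff]
    refine sum_congr rfl fun k hk => ?_
    rw [coeff_mul_frobPoly_pow hp.pos (Nat.succ_le_of_lt (mem_range.mp hk)) (hdeg _ _), T,
      master_eq_prod hp hp2 (n - (k + 1))]
  -- Since `f^p ≡ σ f` modulo p, raising to the power `p^j` improves the congruence to modulus
  -- `p^(j+1)`.
  · refine pow_dvd_coeff_of_natCast_pow_dvd (pow_dvd_ghost _ _ (fun j => ?_) k.succ_pos k) _
    have := dvd_sub_pow_of_dvd_sub (natCast_dvd_master_pow_sub hp 1) j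
    rwa [← pow_mul, ← pow_succ', ← map_pow] at this

/-- This is the Dwork congruence with m = 0, where `T_0 = 1`, combined with `σ^s f ≡ f^(p^s)`. It
lets the single condition on `T_1` control every `T_s`. -/
theorem natCast_dvd_T_succ_sub (hp : p.Prime) (hp2 : p ≠ 2) (s : ℕ) :
    (p : MvPolynomial (Fin 3) ℤ) ∣ T p (s + 1) - T p s * T p 1 ^ p ^ s := by
  have h1 := T_dwork hp hp2 s 0
  simp only [zero_add, pow_one, T_zero, map_one, mul_one] at h1
  have h2 := dvd_mul_of_dvd_right (natCast_dvd_frob_pow_sub_pow hp (T p 1) s) (T p s)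
  rw [mul_sub] at h2
  simpa using dvd_add h1 h2

theorem prime_natCast (hp : p.Prime) : Prime (p : MvPolynomial (Fin 3) ℤ) := by
  rw [← map_natCast (MvPolynomial.C : ℤ →+* MvPolynomial (Fin 3) ℤ)]
  exact (MvPolynomial.prime_C_iff _).mpr (Nat.prime_iff_prime_int.mp hp)

theorem not_natCast_dvd_T (hp : p.Prime) (hp2 : p ≠ 2)
    (h : ¬ (p : MvPolynomial (Fin 3) ℤ) ∣ T p 1) (s : ℕ) :
    ¬ (p : MvPolynomial (Fin 3) ℤ) ∣ T p s := by
  induction s with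
  | zero => rw [T_zero]; exact (prime_natCast hp).not_dvd_one
  | succ s ih =>
    intro hd
    have := (dvd_sub_right hd).mp (natCast_dvd_T_succ_sub hp hp2 s)
    rcases (prime_natCast hp).dvd_or_dvd this with h1 | h1
    · exact ih h1
    · exact h ((prime_natCast hp).dvd_of_dvd_pow h1)

theorem T_logDeriv_congruence (hp : p.Prime) (hp2 : p ≠ 2)
    (h : ¬ (p : MvPolynomial (Fin 3) ℤ) ∣ T p 1) (i : Fin 3) (s : ℕ) :
    (p : MvPolynomial (Fin 3) ℤ) ^ s ∣
      T p s * MvPolynomial.pderiv i (T p (s + 1)) -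
        T p (s + 1) * MvPolynomial.pderiv i (T p s) := by
  refine logDeriv_congruence (frob p) (prime_natCast hp) (T p) (fun n => ?_) (fun n hd => ?_)
    (MvPolynomial.pderiv i) (MvPolynomial.X i ^ (p - 1)) (fun f => pderiv_frob i f) s
  · simpa using T_dwork hp hp2 1 n
  · have h1 := (dvd_sub_right hd).mp (natCast_dvd_frob_sub_pow hp (T p n))
    exact not_natCast_dvd_T hp hp2 h n ((prime_natCast hp).dvd_of_dvd_pow h1)

end TCongruences

/-! ### Differential equations for the master polynomial and for `T_s`. -/

section DifferentialEquations

open Polynomial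

/-- The derivation of `A[t]` that applies a derivation of `A` to the coefficients. -/
noncomputable def coeffDeriv {A : Type*} [CommRing A] (D : Derivation ℤ A A) :
    Derivation ℤ A[X] A[X] :=
  letI : Differential A := ⟨D⟩
  Differential.mapCoeffs

variable {A : Type*} [CommRing A] (D : Derivation ℤ A A)

@[simp] theorem coeff_coeffDeriv (f : A[X]) (n : ℕ) :
    (coeffDeriv D f).coeff n = D (f.coeff n) := rfl

@[simp] theorem coeffDeriv_X : coeffDeriv D X = 0 := by
  ext n
  rw [coeff_coeffDeriv, coeff_X]
  split_ifs <;> simp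

@[simp] theorem coeffDeriv_C (a : A) : coeffDeriv D (C a) = C (D a) := by
  ext n
  rw [coeff_coeffDeriv, coeff_C, coeff_C]
  split_ifs <;> simp

theorem coeff_X_mul_derivative (f : A[X]) (n : ℕ) :
    (X * derivative f).coeff n = n * f.coeff n := by
  cases n with
  | zero => simp
  | succ n => rw [coeff_X_mul, coeff_derivative]; push_cast; ring

/-- The derivation `∂/∂z_i` of `ℤ[z_1, z_2, z_3][t]`. -/
noncomputable def dz (i : Fin 3) :
    Derivation ℤ (MvPolynomial (Fin 3) ℤ)[X] (MvPolynomial (Fin 3) ℤ)[X] :=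
  coeffDeriv (MvPolynomial.pderiv i)

@[simp] theorem coeff_dz (i : Fin 3) (f : (MvPolynomial (Fin 3) ℤ)[X]) (n : ℕ) :
    (dz i f).coeff n = MvPolynomial.pderiv i (f.coeff n) := rfl

@[simp] theorem dz_X (i : Fin 3) : dz i X = 0 := coeffDeriv_X _

@[simp] theorem dz_C (i : Fin 3) (a : MvPolynomial (Fin 3) ℤ) :
    dz i (C a) = C (MvPolynomial.pderiv i a) := coeffDeriv_C _ a

theorem pderiv_comm {R σ : Type*} [CommRing R] (i j : σ) (f : MvPolynomial σ R) :
    MvPolynomial.pderiv i (MvPolynomial.pderiv j f) =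
      MvPolynomial.pderiv j (MvPolynomial.pderiv i f) := by
  classical
  have h : ⁅MvPolynomial.pderiv (R := R) i, MvPolynomial.pderiv (R := R) j⁆ = 0 := by
    refine MvPolynomial.derivation_ext fun k => ?_
    rw [Derivation.commutator_apply, MvPolynomial.pderiv_X, MvPolynomial.pderiv_X]
    simp only [Pi.single_apply]
    split_ifs <;> simp
  have := DFunLike.congr_fun h f
  rw [Derivation.commutator_apply] at this
  exact sub_eq_zero.mp this

theorem dz_linear_self (i : Fin 3) :
    dz i (X - C (MvPolynomial.X i : MvPolynomial (Fin 3) ℤ)) = -1 := by simp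

theorem dz_linear_of_ne {i j : Fin 3} (h : j ≠ i) :
    dz i (X - C (MvPolynomial.X j : MvPolynomial (Fin 3) ℤ)) = 0 := by
  simp [MvPolynomial.pderiv_X_of_ne h]

variable (p s : ℕ)

theorem sub_mul_dz_master (i : Fin 3) :
    (X - C (MvPolynomial.X i)) * dz i (master p s) =
      -(((p ^ s - 1) / 2 : ℕ) : (MvPolynomial (Fin 3) ℤ)[X]) * master p s := by
  rw [master, ← mul_prod_erase univ _ (mem_univ i), mul_pow]
  have h0 : dz i (∏ j ∈ univ.erase i, (X - C (MvPolynomial.X j))) = 0 := by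
    refine prod_induction _ (fun f => dz i f = 0) (fun f g hf hg => ?_) (Derivation.map_one_eq_zero _)
      fun j hj => dz_linear_of_ne (ne_of_mem_erase hj)
    simp [hf, hg]
  rw [Derivation.leibniz, Derivation.leibniz_pow, Derivation.leibniz_pow, h0, dz_linear_self]
  cases (p ^ s - 1) / 2 with
  | zero => simp
  | succ N =>
    simp only [smul_eq_mul, Nat.add_sub_cancel, nsmul_eq_mul]
    ring

/-- Infinitesimal form of invariance under simultaneous translation of t and the `z_i`. -/
theorem derivative_master_add_sum_dz :
    derivative (master p s) + ∑ i, dz i (master p s) = 0 := by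
  have h (i j : Fin 3) : dz i (X - C (MvPolynomial.X j : MvPolynomial (Fin 3) ℤ)) =
      if j = i then -1 else 0 := by
    split_ifs with h
    · subst h; exact dz_linear_self _
    · exact dz_linear_of_ne h
  rw [master]
  simp only [Fin.sum_univ_three, derivative_pow, Derivation.leibniz_pow, Fin.prod_univ_three,
    Derivation.leibniz, h, derivative_mul, derivative_sub, derivative_X, derivative_C,
    smul_eq_mul, nsmul_eq_mul, map_natCast]
  simp
  ring

theorem euler_master :
    X * derivative (master p s) + ∑ i, C (MvPolynomial.X i) * dz i (master p s) =
      3 * (((p ^ s - 1) / 2 : ℕ) : (MvPolynomial (Fin 3) ℤ)[X]) * master p s := by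
  have h (i j : Fin 3) : dz i (X - C (MvPolynomial.X j : MvPolynomial (Fin 3) ℤ)) =
      if j = i then -1 else 0 := by
    split_ifs with h
    · subst h; exact dz_linear_self _
    · exact dz_linear_of_ne h
  rw [master]
  simp only [Fin.sum_univ_three, derivative_pow, Derivation.leibniz_pow, Fin.prod_univ_three,
    Derivation.leibniz, h, derivative_mul, derivative_sub, derivative_X, derivative_C,
    smul_eq_mul, nsmul_eq_mul, map_natCast]
  cases (p ^ s - 1) / 2 with
  | zero => simp
  | succ N =>
    simp
    ring

/-- The coefficient of `t^(p^s-1)` in a t-derivative is `p^s` times the next coefficient. -/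
theorem natCast_pow_dvd_sum_pderiv_T (hp : 0 < p) :
    (p : MvPolynomial (Fin 3) ℤ) ^ s ∣ ∑ i, MvPolynomial.pderiv i (T p s) := by
  have h := congrArg (fun f => f.coeff (p ^ s - 1)) (derivative_master_add_sum_dz p s)
  simp only [coeff_add, finsetSum_coeff, coeff_dz, coeff_derivative, coeff_zero] at h
  have h1 : ((p ^ s - 1 : ℕ) : MvPolynomial (Fin 3) ℤ) + 1 = p ^ s := by
    have : p ^ s - 1 + 1 = p ^ s := Nat.sub_add_cancel (pow_pos hp s)
    exact_mod_cast congrArg (Nat.cast (R := MvPolynomial (Fin 3) ℤ)) this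
  rw [h1] at h
  refine ⟨-(master p s).coeff (p ^ s - 1 + 1), ?_⟩
  simp only [T]
  linear_combination h

/-- With N = (p^s-1)/2 the master polynomial is homogeneous of degree 3N, and the coefficient of
`t^(2N)` has degree N. -/
theorem euler_T (hp : Odd p) :
    ∑ i, MvPolynomial.X i * MvPolynomial.pderiv i (T p s) =
      (((p ^ s - 1) / 2 : ℕ) : MvPolynomial (Fin 3) ℤ) * T p s := by
  have h := congrArg (fun f => f.coeff (p ^ s - 1)) (euler_master p s)
  have h3 : (3 * (((p ^ s - 1) / 2 : ℕ) : (MvPolynomial (Fin 3) ℤ)[X]) * master p s).coeff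
      (p ^ s - 1) = 3 * (((p ^ s - 1) / 2 : ℕ) : MvPolynomial (Fin 3) ℤ) * T p s := by
    have : (3 * (((p ^ s - 1) / 2 : ℕ) : (MvPolynomial (Fin 3) ℤ)[X])) =
      C (3 * (((p ^ s - 1) / 2 : ℕ) : MvPolynomial (Fin 3) ℤ)) := by
      rw [C_mul, C_eq_natCast, C_ofNat]
    rw [this, coeff_C_mul, T]
  simp only [coeff_add, finsetSum_coeff, coeff_C_mul, coeff_dz,
    coeff_X_mul_derivative] at h
  rw [h3] at h
  obtain ⟨m, hm⟩ := hp.pow (n := s)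
  have h1 : ((p ^ s - 1 : ℕ) : MvPolynomial (Fin 3) ℤ) =
      2 * (((p ^ s - 1) / 2 : ℕ) : MvPolynomial (Fin 3) ℤ) := by
    have : p ^ s - 1 = 2 * ((p ^ s - 1) / 2) := by omega
    exact_mod_cast congrArg (Nat.cast (R := MvPolynomial (Fin 3) ℤ)) this
  rw [h1] at h
  simp only [T] at h ⊢
  linear_combination h

/-- Differentiate `(t - z_i) ∂_i Φ = -N Φ` in `z_j`, do the same with i and j exchanged, and
subtract: t drops out, so the identity holds coefficientwise. -/
theorem euler_darboux_T {i j : Fin 3} (hij : i ≠ j) :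
    (MvPolynomial.X i - MvPolynomial.X j) *
        MvPolynomial.pderiv i (MvPolynomial.pderiv j (T p s)) =
      -(((p ^ s - 1) / 2 : ℕ) : MvPolynomial (Fin 3) ℤ) *
        (MvPolynomial.pderiv i (T p s) - MvPolynomial.pderiv j (T p s)) := by
  have hcomm : dz j (dz i (master p s)) = dz i (dz j (master p s)) := by
    ext1 n
    simp only [coeff_dz]
    exact pderiv_comm _ _ _
  have h1 := congrArg (dz j) (sub_mul_dz_master p s i)
  have h2 := congrArg (dz i) (sub_mul_dz_master p s j)
  rw [Derivation.leibniz, Derivation.leibniz, dz_linear_of_ne hij, map_neg, Derivation.map_natCast, hcomm] at h1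
  rw [Derivation.leibniz, Derivation.leibniz, dz_linear_of_ne hij.symm, map_neg,
    Derivation.map_natCast] at h2
  simp only [smul_eq_mul, mul_zero, add_zero] at h1 h2
  have h3 : C (MvPolynomial.X i - MvPolynomial.X j) * dz i (dz j (master p s)) =
      C (-(((p ^ s - 1) / 2 : ℕ) : MvPolynomial (Fin 3) ℤ)) *
        (dz i (master p s) - dz j (master p s)) := by
    simp only [map_sub, map_neg, C_eq_natCast]
    linear_combination h2 - h1
  have h4 := congrArg (fun f => f.coeff (p ^ s - 1)) h3
  simpa only [coeff_C_mul, coeff_sub, coeff_dz, T] using h4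

end DifferentialEquations

/-! ### Integral power series as analytic maps on residue polydiscs. -/

section PowerSeries

open Filter Topology MvPowerSeries
open scoped MvPowerSeries.WithPiTopology

variable {p : ℕ} [Fact p.Prime]

/-- The ideals generated by the powers of p are a basis at 0; evaluation of power series over
`ℤ_[p]` relies on this. -/
instance isLinearTopology_padicInt : IsLinearTopology ℤ_[p] ℤ_[p] := by
  have hp1 : (1 : ℝ) < p := mod_cast (Fact.out : p.Prime).one_lt
  have h := Metric.nhds_basis_closedBall_pow (α := ℤ_[p]) (x := 0)
    (inv_pos.mpr (zero_lt_one.trans hp1)) (inv_lt_one_of_one_lt₀ hp1)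
  refine IsLinearTopology.mk_of_hasBasis ℤ_[p] (p := fun _ : ℕ => True)
    (s := fun n : ℕ => (Ideal.span {(p : ℤ_[p]) ^ n} : Ideal ℤ_[p])) ?_
  convert h using 2 with n
  ext x
  rw [SetLike.mem_coe, ← PadicInt.norm_le_pow_iff_mem_span_pow, mem_closedBall_zero_iff, inv_pow,
    zpow_neg, zpow_natCast]

theorem hasEval_of_norm_lt_one {y : Fin 3 → ℤ_[p]} (hy : ∀ i, ‖y i‖ < 1) : HasEval y where
  hpow i := tendsto_pow_atTop_nhds_zero_of_norm_lt_one (hy i)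
  tendsto_zero := by simp

/-- The letters of a monomial of degree `n` in three variables, as a word of length `n`. -/
noncomputable def letters (d : Fin 3 →₀ ℕ) (n : ℕ) (k : Fin n) : Fin 3 :=
  (Finsupp.toMultiset d).toList.getD k 0

theorem prod_letters {M : Type*} [CommMonoid M] {d : Fin 3 →₀ ℕ} {n : ℕ}
    (hd : d ∈ finsuppAntidiag univ n) (y : Fin 3 → M) :
    ∏ k, y (letters d n k) = d.prod fun i e => y i ^ e := by
  have hlen : (Finsupp.toMultiset d).toList.length = n := by
    rw [Multiset.length_toList, Finsupp.card_toMultiset]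
    exact (mem_finsuppAntidiag'.mp hd).1
  have h1 : (d.prod fun i e => y i ^ e) = ((Finsupp.toMultiset d).map y).prod := by
    rw [Finsupp.toMultiset_map, Finsupp.prod_toMultiset, Finsupp.prod_mapDomain_index] <;>
      simp [pow_add]
  rw [h1, ← Multiset.coe_toList (Finsupp.toMultiset d), Multiset.map_coe, Multiset.prod_coe]
  subst hlen
  rw [← Fin.prod_univ_fun_getElem]
  exact prod_congr rfl fun k _ => congrArg y (List.getD_eq_getElem _ _ k.2)

/-- The multilinear form attached to a monomial of degree `n`. -/
noncomputable def monomialForm (p : ℕ) [Fact p.Prime] (d : Fin 3 →₀ ℕ) (n : ℕ) :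
    ContinuousMultilinearMap ℚ_[p] (fun _ : Fin n => Fin 3 → ℚ_[p]) ℚ_[p] :=
  (ContinuousMultilinearMap.mkPiAlgebra ℚ_[p] (Fin n) ℚ_[p]).compContinuousLinearMap
    fun k => ContinuousLinearMap.proj (letters d n k)

@[simp] theorem monomialForm_apply (d : Fin 3 →₀ ℕ) (n : ℕ) (m : Fin n → Fin 3 → ℚ_[p]) :
    monomialForm p d n m = ∏ k, m k (letters d n k) := rfl

/-- The formal multilinear series of a triple of power series with `p`-adic integer
coefficients. -/
noncomputable def multilinearSeries (G : Fin 3 → MvPowerSeries (Fin 3) ℤ_[p]) :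
    FormalMultilinearSeries ℚ_[p] (Fin 3 → ℚ_[p]) (Fin 3 → ℚ_[p]) := fun n =>
  ContinuousMultilinearMap.pi fun j =>
    ∑ d ∈ finsuppAntidiag univ n, ((coeff d (G j) : ℤ_[p]) : ℚ_[p]) • monomialForm p d n

theorem multilinearSeries_apply (G : Fin 3 → MvPowerSeries (Fin 3) ℤ_[p]) (n : ℕ)
    (m : Fin n → Fin 3 → ℚ_[p]) (j : Fin 3) :
    multilinearSeries G n m j =
      ∑ d ∈ finsuppAntidiag univ n, ((coeff d (G j) : ℤ_[p]) : ℚ_[p]) * ∏ k, m k (letters d n k) := by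
  simp [multilinearSeries]

theorem multilinearSeries_apply_const (G : Fin 3 → MvPowerSeries (Fin 3) ℤ_[p]) (n : ℕ)
    (y : Fin 3 → ℚ_[p]) (j : Fin 3) :
    multilinearSeries G n (fun _ => y) j =
      ∑ d ∈ finsuppAntidiag univ n, ((coeff d (G j) : ℤ_[p]) : ℚ_[p]) * d.prod fun i e => y i ^ e := by
  rw [multilinearSeries_apply]
  exact sum_congr rfl fun d hd => by rw [prod_letters hd]

theorem norm_multilinearSeries_le (G : Fin 3 → MvPowerSeries (Fin 3) ℤ_[p]) (n : ℕ) :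
    ‖multilinearSeries G n‖ ≤ 1 := by
  refine ContinuousMultilinearMap.opNorm_le_bound zero_le_one fun m => ?_
  have h0 : 0 ≤ 1 * ∏ k, ‖m k‖ := by positivity
  refine (pi_norm_le_iff_of_nonneg h0).mpr fun j => ?_
  rw [multilinearSeries_apply]
  refine IsUltrametricDist.norm_sum_le_of_forall_le_of_nonneg h0 fun d _ => ?_
  rw [norm_mul]
  refine mul_le_mul (PadicInt.norm_le_one _) ?_ (norm_nonneg _) zero_le_one
  rw [norm_prod]
  exact prod_le_prod (fun _ _ => norm_nonneg _) fun k _ => norm_le_pi_norm _ _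

theorem one_le_radius_multilinearSeries (G : Fin 3 → MvPowerSeries (Fin 3) ℤ_[p]) :
    1 ≤ (multilinearSeries G).radius :=
  (multilinearSeries G).le_radius_of_bound (r := 1) 1 fun n => by
    simpa using norm_multilinearSeries_le G n

theorem multilinearSeries_one_single (G : Fin 3 → MvPowerSeries (Fin 3) ℤ_[p]) (i j : Fin 3) :
    multilinearSeries G 1 (fun _ => Pi.single i 1) j = coeff (Finsupp.single i 1) (G j) := by
  rw [multilinearSeries_apply_const, sum_eq_single (Finsupp.single i 1)]
  · simp
  · intro d hd hne
    have : ∃ k ∈ d.support, k ≠ i := by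
      by_contra! h
      apply hne
      have h1 : d = Finsupp.single i (d i) :=
        Finsupp.eq_single_iff.mpr ⟨fun k hk => by simpa using h k hk, rfl⟩
      have h2 := (mem_finsuppAntidiag'.mp hd).1
      rw [h1, Finsupp.sum_single_index rfl] at h2
      rw [h1, h2]
    obtain ⟨k, hk, hki⟩ := this
    rw [Finsupp.prod, prod_eq_zero hk, mul_zero]
    rw [Pi.single_eq_of_ne hki, zero_pow (Finsupp.mem_support_iff.mp hk)]
  · intro h
    refine absurd (mem_finsuppAntidiag'.mpr ⟨?_, subset_univ _⟩) h
    simp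

/-- The sum over all monomials is regrouped by total degree, each degree contributing a finite inner
sum. -/
theorem hasSum_multilinearSeries (G : Fin 3 → MvPowerSeries (Fin 3) ℤ_[p])
    {y : Fin 3 → ℤ_[p]} (hy : HasEval y) :
    HasSum (fun n => multilinearSeries G n fun _ i => (y i : ℚ_[p]))
      (fun j => (aeval hy (G j) : ℚ_[p])) := by
  refine Pi.hasSum.mpr fun j => ?_
  have h1 := (hasSum_aeval hy (G j)).map (PadicInt.Coe.ringHom (p := p)) continuous_subtype_val
  let e : (Σ n : ℕ, (finsuppAntidiag (univ : Finset (Fin 3)) n)) ≃ (Fin 3 →₀ ℕ) :=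
    { toFun := fun x => x.2.1
      invFun := fun d => ⟨d.sum fun _ x => x, d, mem_finsuppAntidiag'.mpr ⟨rfl, subset_univ _⟩⟩
      left_inv := by
        rintro ⟨n, d, hd⟩
        obtain ⟨rfl, -⟩ := mem_finsuppAntidiag'.mp hd
        rfl
      right_inv := fun d => rfl }
  rw [← e.hasSum_iff] at h1
  refine h1.sigma fun n => ?_
  rw [multilinearSeries_apply_const]
  have h2 := Finset.hasSum (finsuppAntidiag (univ : Finset (Fin 3)) n) fun d =>
    ((coeff d (G j) : ℤ_[p]) : ℚ_[p]) * d.prod fun i e => (y i : ℚ_[p]) ^ e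
  refine Eq.mpr (congrArg (HasSum · _) (funext fun d => ?_)) h2
  simp only [e, Finsupp.prod, Function.comp_apply, Equiv.coe_fn_mk, smul_eq_mul, map_mul, map_prod,
    map_pow]
  rfl

theorem exists_padicInt_lift {y : Fin 3 → ℚ_[p]} (hy : ∀ i, ‖y i‖ ≤ 1) :
    ∃ x : Fin 3 → ℤ_[p], (fun i => (x i : ℚ_[p])) = y :=
  ⟨fun i => ⟨y i, hy i⟩, rfl⟩

theorem hasFPowerSeriesOnBall_multilinearSeries (G : Fin 3 → MvPowerSeries (Fin 3) ℤ_[p])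
    {f : (Fin 3 → ℚ_[p]) → (Fin 3 → ℚ_[p])} {a : Fin 3 → ℚ_[p]}
    (h : ∀ (y : Fin 3 → ℤ_[p]) (hy : ∀ i, ‖y i‖ < 1) (j : Fin 3),
      f (a + fun i => (y i : ℚ_[p])) j = aeval (hasEval_of_norm_lt_one hy) (G j)) :
    HasFPowerSeriesOnBall f (multilinearSeries G) a 1 where
  r_le := one_le_radius_multilinearSeries G
  r_pos := zero_lt_one
  hasSum {y} hy := by
    have hy1 : ‖y‖ < 1 := by
      simpa [edist_zero_right, ← ofReal_norm, ENNReal.ofReal_lt_one] using hy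
    have hy2 (i : Fin 3) : ‖y i‖ < 1 := (norm_le_pi_norm y i).trans_lt hy1
    obtain ⟨x, rfl⟩ := exists_padicInt_lift fun i => (hy2 i).le
    have hx : HasEval x := hasEval_of_norm_lt_one hy2
    have := hasSum_multilinearSeries G hx
    rwa [← funext (h x hy2)] at this

theorem fderiv_single_of_multilinearSeries {G : Fin 3 → MvPowerSeries (Fin 3) ℤ_[p]}
    {f : (Fin 3 → ℚ_[p]) → (Fin 3 → ℚ_[p])} {a : Fin 3 → ℚ_[p]}
    (h : HasFPowerSeriesOnBall f (multilinearSeries G) a 1) (i j : Fin 3) :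
    fderiv ℚ_[p] f a (Pi.single i 1) j = coeff (Finsupp.single i 1) (G j) := by
  rw [h.hasFPowerSeriesAt.fderiv_eq, ← multilinearSeries_one_single]
  simp only [continuousMultilinearCurryFin1_apply]
  congr 2

/-- Each coefficient is a Cauchy sequence in `ℤ_[p]`, and the topology on power series is
coefficientwise. -/
theorem exists_tendsto_coeff {G : ℕ → MvPowerSeries (Fin 3) ℤ_[p]}
    (h : ∀ s, (p : MvPowerSeries (Fin 3) ℤ_[p]) ^ s ∣ G (s + 1) - G s) :
    ∃ G', Tendsto G atTop (𝓝 G') := by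
  have hp1 : (1 : ℝ) < p := mod_cast (Fact.out : p.Prime).one_lt
  have hc (d : Fin 3 →₀ ℕ) : ∃ c, Tendsto (fun s => coeff d (G s)) atTop (𝓝 c) := by
    refine cauchySeq_tendsto_of_complete
      (cauchySeq_of_le_geometric (p : ℝ)⁻¹ 1 (inv_lt_one_of_one_lt₀ hp1) fun s => ?_)
    obtain ⟨Y, hY⟩ := h s
    have h1 := congrArg (coeff d) hY
    rw [← Nat.cast_pow, ← map_natCast (C : ℤ_[p] →+* MvPowerSeries (Fin 3) ℤ_[p]), coeff_C_mul,
      map_sub] at h1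
    rw [dist_comm, dist_eq_norm, h1, norm_mul, Nat.cast_pow, norm_pow, PadicInt.norm_p]
    exact mul_comm (1 : ℝ) _ ▸ mul_le_mul_of_nonneg_left (PadicInt.norm_le_one _) (by positivity)
  choose c hc using hc
  exact ⟨fun d => c d, (WithPiTopology.tendsto_iff_coeff_tendsto _ _ _).mpr hc⟩

/-- The expansion of a polynomial at a point of `ℤ_p^3`. -/
noncomputable def expansion (a : Fin 3 → ℤ_[p]) :
    MvPolynomial (Fin 3) ℤ →ₐ[ℤ] MvPowerSeries (Fin 3) ℤ_[p] :=
  MvPolynomial.aeval fun i => X i + C (a i)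

theorem aeval_expansion (a : Fin 3 → ℤ_[p]) {y : Fin 3 → ℤ_[p]} (hy : HasEval y)
    (f : MvPolynomial (Fin 3) ℤ) :
    aeval hy (expansion a f) = MvPolynomial.aeval (a + y) f := by
  induction f using MvPolynomial.induction_on with
  | C n => simp
  | add f g hf hg => simp only [map_add, hf, hg]
  | mul_X f i hf =>
    have hX : aeval hy (X i : MvPowerSeries (Fin 3) ℤ_[p]) = y i := by
      rw [← MvPolynomial.coe_X, aeval_coe, MvPolynomial.aeval_X]
    have hC : aeval hy (C (a i) : MvPowerSeries (Fin 3) ℤ_[p]) = a i := by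
      rw [← MvPolynomial.coe_C, aeval_coe, MvPolynomial.aeval_C]; rfl
    rw [map_mul, map_mul, hf, map_mul, MvPolynomial.aeval_X, expansion, MvPolynomial.aeval_X,
      map_add, hX, hC, Pi.add_apply, add_comm (a i)]

theorem constantCoeff_expansion (a : Fin 3 → ℤ_[p]) (f : MvPolynomial (Fin 3) ℤ) :
    constantCoeff (expansion a f) = MvPolynomial.aeval a f := by
  induction f using MvPolynomial.induction_on with
  | C n => simp
  | add f g hf hg => simp only [map_add, hf, hg]
  | mul_X f i hf =>
    rw [map_mul, map_mul, hf, map_mul, MvPolynomial.aeval_X, expansion, MvPolynomial.aeval_X]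
    simp

theorem pderiv_expansion (a : Fin 3 → ℤ_[p]) (i : Fin 3) (f : MvPolynomial (Fin 3) ℤ) :
    MvPowerSeries.pderiv ℤ_[p] i (expansion a f) = expansion a (MvPolynomial.pderiv i f) := by
  induction f using MvPolynomial.induction_on with
  | C n => simp
  | add f g hf hg => simp only [map_add, hf, hg]
  | mul_X f j hf =>
    have hj : expansion a (MvPolynomial.X j) = X j + C (a j) := MvPolynomial.aeval_X _ _
    rw [map_mul, Derivation.leibniz, Derivation.leibniz, hf, map_add, hj]
    rcases eq_or_ne j i with rfl | h
    · simp [hj]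
    · simp [hj, MvPolynomial.pderiv_X_of_ne h, MvPowerSeries.pderiv_X_of_ne h]

theorem coeff_single_eq (i : Fin 3) (G : MvPowerSeries (Fin 3) ℤ_[p]) :
    coeff (Finsupp.single i 1) G = constantCoeff (MvPowerSeries.pderiv ℤ_[p] i G) := by
  rw [← coeff_zero_eq_constantCoeff_apply, coeff_pderiv]
  simp

theorem isUnit_expansion {a : Fin 3 → ℤ_[p]} {f : MvPolynomial (Fin 3) ℤ}
    (h : ‖MvPolynomial.aeval a f‖ = 1) : IsUnit (expansion a f) := by
  rw [MvPowerSeries.isUnit_iff_constantCoeff, constantCoeff_expansion]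
  exact PadicInt.isUnit_iff.mpr h

end PowerSeries

/-! ### Convergence of `η_s` and analyticity of the limit. -/

section PadicLimit

open Filter Topology MvPowerSeries
open scoped MvPowerSeries.WithPiTopology

variable {p : ℕ} [hpf : Fact p.Prime]

theorem coe_aeval (x : Fin 3 → ℤ_[p]) (f : MvPolynomial (Fin 3) ℤ) :
    ((MvPolynomial.aeval x f : ℤ_[p]) : ℚ_[p]) =
      MvPolynomial.aeval (fun i => (x i : ℚ_[p])) f :=
  MvPolynomial.comp_aeval_apply x PadicInt.Coe.ringHom.toIntAlgHom f

theorem coe_ne_zero_of_norm_eq_one {c : ℤ_[p]} (h : ‖c‖ = 1) : (c : ℚ_[p]) ≠ 0 := by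
  rw [← norm_pos_iff, ← PadicInt.norm_def, h]
  exact one_pos

theorem norm_aeval_le_of_dvd {x : Fin 3 → ℤ_[p]} {f : MvPolynomial (Fin 3) ℤ} {s : ℕ}
    (h : (p : MvPolynomial (Fin 3) ℤ) ^ s ∣ f) :
    ‖MvPolynomial.aeval x f‖ ≤ (p : ℝ)⁻¹ ^ s := by
  obtain ⟨g, rfl⟩ := h
  rw [map_mul, map_pow, map_natCast, norm_mul, norm_pow, PadicInt.norm_p]
  exact mul_le_of_le_one_right (by positivity) (PadicInt.norm_le_one _)

theorem inv_natCast_lt_one : (p : ℝ)⁻¹ < 1 :=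
  inv_lt_one_of_one_lt₀ (mod_cast hpf.out.one_lt)

theorem norm_aeval_eq_one_iff {x : Fin 3 → ℤ_[p]} {f g : MvPolynomial (Fin 3) ℤ}
    (h : (p : MvPolynomial (Fin 3) ℤ) ∣ f - g) :
    ‖MvPolynomial.aeval x f‖ = 1 ↔ ‖MvPolynomial.aeval x g‖ = 1 := by
  have h1 : ‖MvPolynomial.aeval x f - MvPolynomial.aeval x g‖ < 1 := by
    rw [← map_sub]
    have := norm_aeval_le_of_dvd (x := x) (s := 1) (by simpa using h)
    rw [pow_one] at this
    exact this.trans_lt inv_natCast_lt_one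
  rw [← PadicInt.isUnit_iff, ← PadicInt.isUnit_iff]
  rw [← PadicInt.mem_nonunits, mem_nonunits_iff] at h1
  constructor
  · intro h2
    by_contra h3
    have := IsLocalRing.nonunits_add (mem_nonunits_iff.mpr h1) (mem_nonunits_iff.mpr h3)
    rw [sub_add_cancel] at this
    exact this h2
  · intro h2
    by_contra h3
    have := IsLocalRing.nonunits_add (a := -(MvPolynomial.aeval x f - MvPolynomial.aeval x g))
      (by rwa [mem_nonunits_iff, IsUnit.neg_iff]) (mem_nonunits_iff.mpr h3)
    rw [neg_sub, sub_add_cancel] at this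
    exact this h2

theorem exists_lift_of_mem_domain {z : Fin 3 → ℚ_[p]} (hz : z ∈ domain p) :
    ∃ x : Fin 3 → ℤ_[p], (fun i => (x i : ℚ_[p])) = z ∧ ‖MvPolynomial.aeval x (T p 1)‖ = 1 := by
  obtain ⟨x, rfl⟩ := exists_padicInt_lift hz.1
  refine ⟨x, rfl, ?_⟩
  rw [PadicInt.norm_def, coe_aeval]
  exact hz.2

theorem norm_aeval_T (hp2 : p ≠ 2) {x : Fin 3 → ℤ_[p]} (hx : ‖MvPolynomial.aeval x (T p 1)‖ = 1)
    (s : ℕ) : ‖MvPolynomial.aeval x (T p s)‖ = 1 := by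
  induction s with
  | zero => simp [T_zero]
  | succ s ih =>
    rw [norm_aeval_eq_one_iff (natCast_dvd_T_succ_sub hpf.out hp2 s)]
    simp [ih, hx]

theorem not_natCast_dvd_T_one {x : Fin 3 → ℤ_[p]} (hx : ‖MvPolynomial.aeval x (T p 1)‖ = 1) :
    ¬ (p : MvPolynomial (Fin 3) ℤ) ∣ T p 1 := by
  intro h
  have := norm_aeval_le_of_dvd (x := x) (s := 1) (by simpa using h)
  rw [hx, pow_one] at this
  exact absurd this (not_le.mpr inv_natCast_lt_one)

theorem aeval_T_ne_zero (hp2 : p ≠ 2) (s : ℕ) {z : Fin 3 → ℚ_[p]} (hz : z ∈ domain p) :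
    MvPolynomial.aeval z (T p s) ≠ 0 := by
  obtain ⟨x, rfl, hx⟩ := exists_lift_of_mem_domain hz
  rw [← coe_aeval]
  exact coe_ne_zero_of_norm_eq_one (norm_aeval_T hp2 hx s)

theorem etaApprox_coe (s : ℕ) (x : Fin 3 → ℤ_[p]) (j : Fin 3) :
    etaApprox p s (fun i => (x i : ℚ_[p])) j =
      (MvPolynomial.aeval x (MvPolynomial.pderiv j (T p s)) : ℤ_[p]) /
        (MvPolynomial.aeval x (T p s) : ℤ_[p]) := by
  rw [etaApprox, coe_aeval, coe_aeval]

theorem dist_etaApprox_succ (hp2 : p ≠ 2) {z : Fin 3 → ℚ_[p]} (hz : z ∈ domain p) (s : ℕ) :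
    dist (etaApprox p s z) (etaApprox p (s + 1) z) ≤ 1 * (p : ℝ)⁻¹ ^ s := by
  obtain ⟨x, rfl, hx⟩ := exists_lift_of_mem_domain hz
  rw [one_mul]
  refine (dist_pi_le_iff (by positivity)).mpr fun j => ?_
  have h0 := norm_aeval_T hp2 hx s
  have h1 := norm_aeval_T hp2 hx (s + 1)
  have h2 := norm_aeval_le_of_dvd (x := x)
    (T_logDeriv_congruence hpf.out hp2 (not_natCast_dvd_T_one hx) j s)
  rw [dist_comm, dist_eq_norm, etaApprox_coe, etaApprox_coe]
  have n0 := coe_ne_zero_of_norm_eq_one h0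
  have n1 := coe_ne_zero_of_norm_eq_one h1
  rw [PadicInt.norm_def] at h0 h1 h2
  rw [div_sub_div _ _ n1 n0, norm_div, norm_mul, h0, h1, mul_one, div_one]
  refine le_trans (le_of_eq ?_) h2
  rw [map_sub, map_mul, map_mul]
  push_cast
  congr 1
  ring

theorem tendsto_etaApprox (hp2 : p ≠ 2) {z : Fin 3 → ℚ_[p]} (hz : z ∈ domain p) :
    Tendsto (fun s => etaApprox p s z) atTop (𝓝 (eta p z)) :=
  (cauchySeq_of_le_geometric _ _ inv_natCast_lt_one (dist_etaApprox_succ hp2 hz)).tendsto_limUnder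

theorem tendstoUniformlyOn_etaApprox (hp2 : p ≠ 2) :
    TendstoUniformlyOn (etaApprox p) (eta p) atTop (domain p) := by
  have h1 : Tendsto (fun s : ℕ => 1 * (p : ℝ)⁻¹ ^ s / (1 - (p : ℝ)⁻¹)) atTop (𝓝 0) := by
    have := ((tendsto_pow_atTop_nhds_zero_of_lt_one (inv_nonneg.mpr p.cast_nonneg)
      (inv_natCast_lt_one (p := p))).const_mul 1).div_const (1 - (p : ℝ)⁻¹)
    simpa using this
  refine Metric.tendstoUniformlyOn_iff.mpr fun ε hε => ?_
  filter_upwards [h1.eventually_lt_const hε] with s hs z hz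
  rw [dist_comm]
  exact (dist_le_of_le_geometric_of_tendsto _ _ inv_natCast_lt_one (dist_etaApprox_succ hp2 hz)
    (tendsto_etaApprox hp2 hz) s).trans_lt hs

theorem add_mem_domain {a : Fin 3 → ℤ_[p]} (ha : ‖MvPolynomial.aeval a (T p 1)‖ = 1)
    {y : Fin 3 → ℤ_[p]} (hy : ∀ i, ‖y i‖ < 1) :
    ‖MvPolynomial.aeval (a + y) (T p 1)‖ = 1 := by
  have h := isUnit_expansion ha
  have h1 := h.map (MvPowerSeries.aeval (hasEval_of_norm_lt_one hy))
  rw [aeval_expansion] at h1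
  exact PadicInt.isUnit_iff.mp h1

theorem coe_mem_domain {x : Fin 3 → ℤ_[p]} (hx : ‖MvPolynomial.aeval x (T p 1)‖ = 1) :
    (fun i => (x i : ℚ_[p])) ∈ domain p :=
  ⟨fun i => PadicInt.norm_le_one (x i), by rw [← coe_aeval, ← PadicInt.norm_def, hx]⟩

theorem ball_subset_domain {a : Fin 3 → ℚ_[p]} (ha : a ∈ domain p) :
    Metric.ball a 1 ⊆ domain p := by
  intro z hz
  obtain ⟨x, rfl, hx⟩ := exists_lift_of_mem_domain ha
  rw [mem_ball_iff_norm] at hz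
  have hy (i : Fin 3) : ‖(z - fun i => (x i : ℚ_[p])) i‖ < 1 := (norm_le_pi_norm _ i).trans_lt hz
  obtain ⟨y, hyz⟩ := exists_padicInt_lift fun i => (hy i).le
  have hy' (i : Fin 3) : ‖y i‖ < 1 := by
    have := hy i
    rwa [← hyz] at this
  have : z = fun i => ((x + y) i : ℚ_[p]) := by
    funext i
    have := congrFun hyz i
    simp only [Pi.sub_apply] at this
    simp [this]
  rw [this]
  exact coe_mem_domain (add_mem_domain hx hy')

theorem isOpen_domain : IsOpen (domain p) :=
  Metric.isOpen_iff.mpr fun _ ha => ⟨1, one_pos, ball_subset_domain ha⟩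

/-- The expansion of `η` at a point of the domain, and its linear coefficients. -/
theorem exists_powerSeries_eta (hp2 : p ≠ 2) {a : Fin 3 → ℤ_[p]}
    (ha : ‖MvPolynomial.aeval a (T p 1)‖ = 1) :
    ∃ G : Fin 3 → MvPowerSeries (Fin 3) ℤ_[p],
      HasFPowerSeriesOnBall (eta p) (multilinearSeries G) (fun i => (a i : ℚ_[p])) 1 ∧
      ∀ i j, Tendsto (fun s =>
        (MvPolynomial.aeval (fun i => (a i : ℚ_[p]))
            (MvPolynomial.pderiv i (MvPolynomial.pderiv j (T p s)))) /
          (MvPolynomial.aeval (fun i => (a i : ℚ_[p])) (T p s)) -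
        etaApprox p s (fun i => (a i : ℚ_[p])) i * etaApprox p s (fun i => (a i : ℚ_[p])) j)
        atTop (𝓝 (coeff (Finsupp.single i 1) (G j) : ℤ_[p])) := by
  choose u hu using fun s => isUnit_expansion (norm_aeval_T hp2 ha s)
  -- `A s j` is the expansion of the j-th component of `η_s` at a; the expansion of `T_s` is
  -- invertible because its constant term is a unit.
  set A : ℕ → Fin 3 → MvPowerSeries (Fin 3) ℤ_[p] :=
    fun s j => expansion a (MvPolynomial.pderiv j (T p s)) * ↑(u s)⁻¹ with hA
  have hAu (s : ℕ) (j : Fin 3) :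
      A s j * expansion a (T p s) = expansion a (MvPolynomial.pderiv j (T p s)) := by
    rw [← hu s, hA, Units.inv_mul_cancel_right]
  have hdiff (j : Fin 3) (s : ℕ) :
      (p : MvPowerSeries (Fin 3) ℤ_[p]) ^ s ∣ A (s + 1) j - A s j := by
    have h1 := map_dvd (expansion a)
      (T_logDeriv_congruence hpf.out hp2 (not_natCast_dvd_T_one ha) j s)
    rw [map_pow, map_natCast, map_sub, map_mul, map_mul, ← hAu s j, ← hAu (s + 1) j] at h1
    have h2 : expansion a (T p s) * (A (s + 1) j * expansion a (T p (s + 1))) -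
        expansion a (T p (s + 1)) * (A s j * expansion a (T p s)) =
        (A (s + 1) j - A s j) * (u s * u (s + 1) : (MvPowerSeries (Fin 3) ℤ_[p])ˣ) := by
      rw [Units.val_mul, hu, hu]; ring
    rw [h2] at h1
    exact Units.dvd_mul_right.mp h1
  choose G hG using fun j => exists_tendsto_coeff (hdiff j)
  have heta (s : ℕ) (j : Fin 3) (y : Fin 3 → ℤ_[p]) (hy : HasEval y)
      (hn : ‖MvPolynomial.aeval (a + y) (T p 1)‖ = 1) :
      etaApprox p s (fun i => ((a + y) i : ℚ_[p])) j = (aeval hy (A s j) : ℤ_[p]) := by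
    have h1 := congrArg (aeval hy) (hAu s j)
    rw [map_mul, aeval_expansion, aeval_expansion] at h1
    rw [etaApprox_coe, ← h1, PadicInt.coe_mul, mul_div_cancel_right₀]
    exact coe_ne_zero_of_norm_eq_one (norm_aeval_T hp2 hn s)
  have hcoe : Continuous fun x : ℤ_[p] => (x : ℚ_[p]) := continuous_subtype_val
  refine ⟨G, hasFPowerSeriesOnBall_multilinearSeries G fun y hy j => ?_, fun i j => ?_⟩
  · have hn := add_mem_domain ha hy
    have h1 := (hcoe.comp
      (continuous_aeval (hasEval_of_norm_lt_one hy))).continuousAt.tendsto.comp (hG j)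
    have h2 := ((continuous_apply j).tendsto _).comp (tendsto_etaApprox hp2 (coe_mem_domain hn))
    refine tendsto_nhds_unique h2 (h1.congr fun s => ?_)
    exact (heta s j y _ hn).symm
  · have h1 := hcoe.continuousAt.tendsto.comp
      ((WithPiTopology.tendsto_iff_coeff_tendsto _ _ _).mp (hG j) (Finsupp.single i 1))
    refine h1.congr fun s => ?_
    have hne := coe_ne_zero_of_norm_eq_one (norm_aeval_T hp2 ha s)
    have h2 := congrArg constantCoeff (hAu s j)
    -- Constant terms of the differentiated identity `A · T_s = ∂_j T_s`: this is the quotient rule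
    -- for the linear coefficients of `A s j`.
    have h3 := congrArg (fun f => constantCoeff (MvPowerSeries.pderiv ℤ_[p] i f)) (hAu s j)
    simp only [Derivation.leibniz, pderiv_expansion, map_add, map_mul, smul_eq_mul,
      constantCoeff_expansion, ← coeff_single_eq] at h2 h3
    have h4 := congrArg (fun x : ℤ_[p] => (x : ℚ_[p])) h2
    have h5 := congrArg (fun x : ℤ_[p] => (x : ℚ_[p])) h3
    simp only [PadicInt.coe_mul, PadicInt.coe_add] at h4 h5
    simp only [Function.comp_apply]
    rw [etaApprox_coe, etaApprox_coe, ← coe_aeval, ← coe_aeval]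
    field_simp
    linear_combination ((MvPolynomial.aeval a (T p s) : ℤ_[p]) : ℚ_[p]) * h5 - ((MvPolynomial.aeval a (MvPolynomial.pderiv i (T p s)) : ℤ_[p]) : ℚ_[p]) * h4

end PadicLimit

/-! ### Action of the matrices `H_i` on vectors. -/

section Residues

variable {𝕜 : Type*} [Field 𝕜]

theorem Omega_mulVec {i j : Fin 3} (v : Fin 3 → 𝕜) :
    Matrix.mulVec (Omega 𝕜 i j) v = (v j - v i) • (Pi.single i 1 - Pi.single j 1) := by
  simp only [Omega, Matrix.sub_mulVec, Matrix.add_mulVec]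
  simp only [Matrix.single_mulVec, one_mul]
  ext k
  simp only [Pi.sub_apply, Pi.add_apply, Function.update_apply, Pi.smul_apply, Pi.single_apply,
    smul_eq_mul, Pi.zero_apply]
  split_ifs <;> ring

theorem H_mulVec (i : Fin 3) (z v : Fin 3 → 𝕜) :
    Matrix.mulVec (H i z) v = (2 : 𝕜)⁻¹ • ∑ j ∈ univ.erase i,
      ((z i - z j)⁻¹ * (v j - v i)) • (Pi.single i 1 - Pi.single j 1 : Fin 3 → 𝕜) := by
  rw [H, Matrix.smul_mulVec, Matrix.sum_mulVec]
  congr 1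
  refine sum_congr rfl fun j _ => ?_
  rw [Matrix.smul_mulVec, Omega_mulVec, smul_smul]

theorem H_mulVec_apply_of_ne {i j : Fin 3} (h : j ≠ i) (z v : Fin 3 → 𝕜) :
    Matrix.mulVec (H i z) v j = 2⁻¹ * ((z i - z j)⁻¹ * (v i - v j)) := by
  rw [H_mulVec, Pi.smul_apply, Finset.sum_apply, sum_eq_single j]
  · simp [h]
    ring
  · intro k _ hk
    simp [h, hk.symm]
  · intro hj
    exact absurd (mem_erase.mpr ⟨h, mem_univ j⟩) hj

theorem sum_H_mulVec (i : Fin 3) (z v : Fin 3 → 𝕜) :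
    ∑ j, Matrix.mulVec (H i z) v j = 0 := by
  simp only [H_mulVec, Pi.smul_apply, Finset.sum_apply, ← smul_sum]
  rw [sum_comm]
  simp [← mul_sum]

theorem H_mulVec_smul (i : Fin 3) (z v : Fin 3 → 𝕜) (c : 𝕜) :
    Matrix.mulVec (H i z) (c • v) = c • Matrix.mulVec (H i z) v := Matrix.mulVec_smul _ _ _

end Residues

/-! ### The invariant p-adic line bundle. -/

section PadicBundle

open Filter Topology

variable {p : ℕ} [hpf : Fact p.Prime]

theorem two_mul_half_pow_sub_one (hp2 : p ≠ 2) (s : ℕ) :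
    2 * (((p ^ s - 1) / 2 : ℕ) : ℚ_[p]) = (p : ℚ_[p]) ^ s - 1 := by
  obtain ⟨m, hm⟩ := (hpf.out.odd_of_ne_two hp2).pow (n := s)
  rw [hm, Nat.add_sub_cancel, Nat.mul_div_cancel_left _ two_pos]
  have := congrArg (Nat.cast (R := ℚ_[p])) hm
  push_cast at this
  rw [this]; ring

theorem tendsto_natCast_pow : Tendsto (fun s : ℕ => (p : ℚ_[p]) ^ s) atTop (𝓝 0) :=
  tendsto_pow_atTop_nhds_zero_of_norm_lt_one Padic.norm_p_lt_one

theorem tendsto_half_pow_sub_one (hp2 : p ≠ 2) :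
    Tendsto (fun s : ℕ => (((p ^ s - 1) / 2 : ℕ) : ℚ_[p])) atTop (𝓝 (-2⁻¹)) := by
  have h := ((tendsto_natCast_pow (p := p)).sub_const 1).div_const 2
  have e : ((0 : ℚ_[p]) - 1) / 2 = -2⁻¹ := by rw [zero_sub, neg_div, one_div]
  rw [e] at h
  refine h.congr fun s => ?_
  rw [← two_mul_half_pow_sub_one hp2, mul_div_cancel_left₀ _ two_ne_zero]

theorem tendsto_etaApprox_apply (hp2 : p ≠ 2) {z : Fin 3 → ℚ_[p]} (hz : z ∈ domain p) (i : Fin 3) :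
    Tendsto (fun s => etaApprox p s z i) atTop (𝓝 (eta p z i)) :=
  ((continuous_apply i).tendsto _).comp (tendsto_etaApprox hp2 hz)

theorem sum_eta (hp2 : p ≠ 2) {z : Fin 3 → ℚ_[p]} (hz : z ∈ domain p) : ∑ i, eta p z i = 0 := by
  refine tendsto_nhds_unique
    (tendsto_finsetSum univ fun i _ => tendsto_etaApprox_apply hp2 hz i) ?_
  obtain ⟨x, rfl, hx⟩ := exists_lift_of_mem_domain hz
  refine squeeze_zero_norm (fun s => ?_)
    (tendsto_pow_atTop_nhds_zero_of_lt_one (inv_nonneg.mpr p.cast_nonneg)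
      (inv_natCast_lt_one (p := p)))
  have h1 := norm_aeval_le_of_dvd (x := x) (natCast_pow_dvd_sum_pderiv_T p s hpf.out.pos)
  have h0 := norm_aeval_T hp2 hx s
  rw [PadicInt.norm_def, coe_aeval] at h0 h1
  simp only [etaApprox]
  rw [← sum_div, ← map_sum, norm_div, h0, div_one]
  exact h1

/-- Limit of Euler's identity. The nonzero constant both forbids zeros of η and supplies an analytic
coordinate on the lines. -/
theorem sum_mul_eta (hp2 : p ≠ 2) {z : Fin 3 → ℚ_[p]} (hz : z ∈ domain p) :
    ∑ i, z i * eta p z i = -2⁻¹ := by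
  refine tendsto_nhds_unique
    (tendsto_finsetSum univ fun i _ => (tendsto_etaApprox_apply hp2 hz i).const_mul (z i)) ?_
  refine (tendsto_half_pow_sub_one hp2).congr fun s => ?_
  have h := congrArg (MvPolynomial.aeval z) (euler_T p s (hpf.out.odd_of_ne_two hp2))
  simp only [map_sum, map_mul, MvPolynomial.aeval_X, map_natCast] at h
  simp only [etaApprox, mul_div_assoc']
  rw [← sum_div, h, mul_div_cancel_right₀ _ (aeval_T_ne_zero hp2 s hz)]

theorem eta_ne_zero (hp2 : p ≠ 2) {z : Fin 3 → ℚ_[p]} (hz : z ∈ domain p) : eta p z ≠ 0 := by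
  intro h
  have := sum_mul_eta hp2 hz
  simp [h] at this

theorem exists_hasFPowerSeriesOnBall_eta (hp2 : p ≠ 2) {a : Fin 3 → ℚ_[p]} (ha : a ∈ domain p) :
    ∃ q : FormalMultilinearSeries ℚ_[p] (Fin 3 → ℚ_[p]) (Fin 3 → ℚ_[p]),
      HasFPowerSeriesOnBall (eta p) q a 1 := by
  obtain ⟨x, rfl, hx⟩ := exists_lift_of_mem_domain ha
  obtain ⟨G, hG, -⟩ := exists_powerSeries_eta hp2 hx
  exact ⟨_, hG⟩

theorem analyticOnNhd_eta (hp2 : p ≠ 2) : AnalyticOnNhd ℚ_[p] (eta p) (domain p) := by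
  intro a ha
  obtain ⟨q, hq⟩ := exists_hasFPowerSeriesOnBall_eta hp2 ha
  exact hq.analyticAt

/-- Limit of the Euler–Darboux equation divided by `T_s`; the quadratic term comes from
differentiating a quotient. -/
theorem fderiv_eta_apply_of_ne (hp2 : p ≠ 2) {z : Fin 3 → ℚ_[p]} (hz : z ∈ domain p)
    {i j : Fin 3} (hij : z i ≠ z j) :
    fderiv ℚ_[p] (eta p) z (Pi.single i 1) j =
      2⁻¹ * ((z i - z j)⁻¹ * (eta p z i - eta p z j)) - eta p z i * eta p z j := by
  have hz' := hz
  obtain ⟨x, rfl, hx⟩ := exists_lift_of_mem_domain hz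
  obtain ⟨G, hG, hlim⟩ := exists_powerSeries_eta hp2 hx
  rw [fderiv_single_of_multilinearSeries hG]
  refine tendsto_nhds_unique (hlim i j) ?_
  have h := (((tendsto_half_pow_sub_one hp2).neg.mul
    (((tendsto_etaApprox_apply hp2 hz i).sub (tendsto_etaApprox_apply hp2 hz j)).const_mul
      ((x i : ℚ_[p]) - x j)⁻¹)).sub
    ((tendsto_etaApprox_apply hp2 hz i).mul (tendsto_etaApprox_apply hp2 hz j)))
  rw [neg_neg] at h
  refine h.congr fun s => ?_
  have hij' : i ≠ j := fun h => hij (by rw [h])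
  have e := congrArg (MvPolynomial.aeval fun i => (x i : ℚ_[p])) (euler_darboux_T p s hij')
  simp only [map_mul, map_sub, map_neg, map_natCast, MvPolynomial.aeval_X] at e
  have hT := aeval_T_ne_zero hp2 s hz
  have hd : (x i : ℚ_[p]) - x j ≠ 0 := sub_ne_zero.mpr hij
  congr 1
  simp only [etaApprox]
  rw [← sub_div, mul_div_assoc', mul_div_assoc']
  congr 1
  rw [mul_left_comm, ← e, inv_mul_cancel_left₀ hd]

theorem sum_fderiv_eta (hp2 : p ≠ 2) {z : Fin 3 → ℚ_[p]} (hz : z ∈ domain p) (v : Fin 3 → ℚ_[p]) :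
    ∑ j, fderiv ℚ_[p] (eta p) z v j = 0 := by
  have h1 := (analyticOnNhd_eta hp2 z hz).differentiableAt.hasFDerivAt
  have h2 : HasFDerivAt (fun w => ∑ j, eta p w j)
      (∑ j, (ContinuousLinearMap.proj j).comp (fderiv ℚ_[p] (eta p) z)) z :=
    HasFDerivAt.fun_sum fun j _ => (hasFDerivAt_pi'.mp h1) j
  have h3 : HasFDerivAt (fun w => ∑ j, eta p w j) (0 : (Fin 3 → ℚ_[p]) →L[ℚ_[p]] ℚ_[p]) z :=
    (hasFDerivAt_const 0 z).congr_of_eventuallyEq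
      (eventually_of_mem (isOpen_domain.mem_nhds hz) fun w hw => sum_eta hp2 hw)
  have := DFunLike.congr_fun (h2.unique h3) v
  simpa using this

/-- The vector `η` spans a line that is invariant under the KZ operators. -/
theorem nabla_eta (hp2 : p ≠ 2) {z : Fin 3 → ℚ_[p]} (hz : z ∈ domain p)
    (hoff : z ∈ offDiagonals ℚ_[p]) (i : Fin 3) :
    nabla i (eta p) z = -(eta p z i) • eta p z := by
  have hne (j : Fin 3) (hj : j ≠ i) : nabla i (eta p) z j = -(eta p z i) * eta p z j := by
    have hij : z i ≠ z j := fun h => hj (hoff h).symm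
    rw [nabla, Pi.sub_apply, fderiv_eta_apply_of_ne hp2 hz hij, H_mulVec_apply_of_ne hj]
    ring
  -- Both sides have coordinate sum zero, so the remaining i-th coordinate follows from the other
  -- two.
  have hsum : ∑ j, nabla i (eta p) z j = ∑ j, -(eta p z i) * eta p z j := by
    simp only [nabla, Pi.sub_apply]
    rw [sum_sub_distrib, sum_fderiv_eta hp2 hz, sum_H_mulVec, ← mul_sum, sum_eta hp2 hz]
    simp
  funext j
  rw [Pi.smul_apply, smul_eq_mul]
  by_cases hj : j = i
  · subst hj
    rw [← add_sum_erase _ _ (mem_univ j), ← add_sum_erase _ _ (mem_univ j),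
      sum_congr rfl fun k hk => hne k (ne_of_mem_erase hk)] at hsum
    exact add_right_cancel hsum
  · exact hne j hj

theorem isAnalyticLineSubbundle_lineL (hp2 : p ≠ 2) :
    IsAnalyticLineSubbundle (domain p) (lineL p) := fun _ ha =>
  ⟨domain p, isOpen_domain, ha, subset_rfl, eta p, analyticOnNhd_eta hp2, fun _ hz =>
    ⟨sum_eta hp2 hz, eta_ne_zero hp2 hz, rfl⟩⟩

theorem isKZInvariant_lineL (hp2 : p ≠ 2) : IsKZInvariant (domain p) (lineL p) := by
  intro U hU hUD s hs i
  have hcoord (j : Fin 3) : AnalyticOnNhd ℚ_[p] (fun z : Fin 3 → ℚ_[p] => z j) U := fun z _ =>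
    (ContinuousLinearMap.proj (R := ℚ_[p]) (φ := fun _ : Fin 3 => ℚ_[p]) j).analyticAt z
  have happly {g : (Fin 3 → ℚ_[p]) → (Fin 3 → ℚ_[p])} (hg : AnalyticOnNhd ℚ_[p] g U) (j : Fin 3) :
      AnalyticOnNhd ℚ_[p] (fun z => g z j) U := fun z hz =>
    (analyticAt_pi_iff.mp (hg z hz)) j
  -- Since `∑ z_j η_j = -1/2`, this analytic function is the coefficient of the section with respect
  -- to η.
  set f : (Fin 3 → ℚ_[p]) → ℚ_[p] := fun z => -2 * ∑ j, z j * s z j with hf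
  have hfan : AnalyticOnNhd ℚ_[p] f U :=
    analyticOnNhd_const.mul (univ.analyticOnNhd_fun_sum fun j _ => (hcoord j).mul (happly hs.1 j))
  have hsf (z) (hz : z ∈ U) : s z = f z • eta p z := by
    obtain ⟨c, hc⟩ := Submodule.mem_span_singleton.mp (hs.2 z hz)
    have : f z = c := by
      have h1 : ∑ j, z j * (c * eta p z j) = c * ∑ j, z j * eta p z j := by
        rw [mul_sum]; exact sum_congr rfl fun j _ => by ring
      simp only [hf, ← hc, Pi.smul_apply, smul_eq_mul, h1, sum_mul_eta hp2 (hUD hz)]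
      field_simp
    rw [this, hc]
  have heta : AnalyticOnNhd ℚ_[p] (eta p) U := (analyticOnNhd_eta hp2).mono hUD
  -- By the Leibniz rule and `∇_i η = -η_i η`, this is `∇_i (f η)` off the diagonals; the formula
  -- itself has no poles.
  refine ⟨fun z => (fderiv ℚ_[p] f z (Pi.single i 1) - f z * eta p z i) • eta p z,
    ⟨AnalyticOnNhd.smul (AnalyticOnNhd.sub ?_ (hfan.mul (happly heta i))) heta,
      fun z _ => Submodule.smul_mem _ _ (Submodule.mem_span_singleton_self _)⟩, ?_⟩
  · exact fun z hz => (ContinuousLinearMap.apply ℚ_[p] ℚ_[p]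
      (Pi.single i 1 : Fin 3 → ℚ_[p])).analyticAt _ |>.comp (hfan.fderiv z hz)
  · rintro z ⟨hz, hoff⟩
    have h1 := (hfan z hz).differentiableAt.hasFDerivAt
    have h2 := (heta z hz).differentiableAt.hasFDerivAt
    have h3 : HasFDerivAt s (f z • fderiv ℚ_[p] (eta p) z +
        (fderiv ℚ_[p] f z).smulRight (eta p z)) z :=
      (h1.fun_smul h2).congr_of_eventuallyEq (eventually_of_mem (hU.mem_nhds hz) hsf)
    have h4 := nabla_eta hp2 (hUD hz) hoff i
    rw [nabla, sub_eq_iff_eq_add] at h4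
    rw [nabla, h3.fderiv, hsf z hz, H_mulVec_smul]
    simp only [_root_.add_apply, _root_.smul_apply,
      ContinuousLinearMap.smulRight_apply, h4]
    module

end PadicBundle

/-! ### Flat sections of complex line bundles and their continuation. -/

section FlatSections

open Metric

variable {E : Type*} [NormedAddCommGroup E] [NormedSpace ℂ E]

/-- `h` is a nowhere vanishing solution over `U` of the differential equation `h' = A h` with values
in the family `L` of subspaces. -/
def FlatOn (A : ℂ → E →L[ℂ] E) (L : ℂ → Submodule ℂ E) (U : Set ℂ) (h : ℂ → E) : Prop :=
  ∀ y ∈ U, HasDerivAt h (A y (h y)) y ∧ h y ∈ L y ∧ h y ≠ 0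

variable {A : ℂ → E →L[ℂ] E} {L : ℂ → Submodule ℂ E} {U V : Set ℂ} {g h : ℂ → E}

theorem FlatOn.mono (hh : FlatOn A L U h) (hVU : V ⊆ U) : FlatOn A L V h :=
  fun y hy => hh y (hVU hy)

theorem FlatOn.const_smul (hh : FlatOn A L U h) {c : ℂ} (hc : c ≠ 0) :
    FlatOn A L U (c • h) := fun y hy => by
  obtain ⟨h1, h2, h3⟩ := hh y hy
  refine ⟨?_, Submodule.smul_mem _ _ h2, smul_ne_zero hc h3⟩
  rw [Pi.smul_apply, map_smul]
  exact h1.const_smul c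

theorem FlatOn.congr (hh : FlatOn A L U h) (hU : IsOpen U) (hgh : Set.EqOn g h U) :
    FlatOn A L U g := fun y hy => by
  rw [hgh hy]
  exact ⟨(hh y hy).1.congr_of_eventuallyEq (Filter.eventually_of_mem (hU.mem_nhds hy) hgh),
    (hh y hy).2⟩

/-- Two flat sections of a line bundle over a connected open set are proportional. -/
theorem FlatOn.exists_eq_smul (hg : FlatOn A L U g) (hh : FlatOn A L U h) (hU : IsOpen U)
    (hUc : IsPreconnected U)
    (hL : ∀ y ∈ U, ∀ v ∈ L y, v ≠ 0 → ∀ w ∈ L y, ∃ c : ℂ, w = c • v) :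
    ∃ c : ℂ, c ≠ 0 ∧ ∀ y ∈ U, g y = c • h y := by
  rcases U.eq_empty_or_nonempty with rfl | ⟨y₀, hy₀⟩
  · exact ⟨1, one_ne_zero, by simp⟩
  have hex (y : ℂ) : ∃ c : ℂ, y ∈ U → g y = c • h y := by
    by_cases hy : y ∈ U
    · obtain ⟨c, hc⟩ := hL y hy _ (hh y hy).2.1 (hh y hy).2.2 _ (hg y hy).2.1
      exact ⟨c, fun _ => hc⟩
    · exact ⟨0, fun h => absurd h hy⟩
  choose f hf using hex
  -- Near y the ratio is `φ(g)/φ(h)` for a functional φ with `φ (h y) ≠ 0`. Its derivative vanishes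
  -- because g and h solve the same linear equation and are proportional at y.
  have hderiv (y) (hy : y ∈ U) : HasDerivAt f 0 y := by
    obtain ⟨φ, hφ⟩ := SeparatingDual.exists_ne_zero (R := ℂ) (hh y hy).2.2
    have dh : HasDerivAt (fun x => φ (h x)) (φ (A y (h y))) y :=
      φ.hasFDerivAt.comp_hasDerivAt y (hh y hy).1
    have dg : HasDerivAt (fun x => φ (g x)) (φ (A y (g y))) y :=
      φ.hasFDerivAt.comp_hasDerivAt y (hg y hy).1
    have hev : ∀ᶠ x in nhds y, f x = φ (g x) / φ (h x) := by
      filter_upwards [hU.mem_nhds hy, dh.continuousAt.eventually_ne hφ] with x hx hx'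
      rw [hf x hx, map_smul, smul_eq_mul, mul_div_cancel_right₀ _ hx']
    refine ((dg.fun_div dh hφ).congr_of_eventuallyEq hev).congr_deriv ?_
    rw [hf y hy, map_smul, map_smul, map_smul, smul_eq_mul, smul_eq_mul]
    ring
  have hconst (y) (hy : y ∈ U) : f y = f y₀ :=
    hU.is_const_of_deriv_eq_zero hUc (fun x hx => (hderiv x hx).differentiableAt.differentiableWithinAt)
      (fun x hx => (hderiv x hx).deriv) hy hy₀
  refine ⟨f y₀, fun h0 => (hg y₀ hy₀).2.2 ?_, fun y hy => by rw [← hconst y hy]; exact hf y hy⟩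
  rw [hf y₀ hy₀, h0, zero_smul]

/-- Gluing of flat sections along a connected intersection. -/
theorem FlatOn.exists_union (hg : FlatOn A L U g) (hh : FlatOn A L V h) (hU : IsOpen U)
    (hV : IsOpen V) (hUV : IsPreconnected (U ∩ V))
    (hL : ∀ y ∈ U, ∀ v ∈ L y, v ≠ 0 → ∀ w ∈ L y, ∃ c : ℂ, w = c • v) :
    ∃ k, FlatOn A L (U ∪ V) k := by
  classical
  obtain ⟨c, hc, hgc⟩ := (hg.mono Set.inter_subset_left).exists_eq_smul
    (hh.mono Set.inter_subset_right) (hU.inter hV) hUV fun y hy => hL y hy.1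
  have e1 : Set.EqOn (fun y => if y ∈ U then g y else c • h y) g U := fun y hy => if_pos hy
  have e2 : Set.EqOn (fun y => if y ∈ U then g y else c • h y) (c • h) V := fun y hy => by
    by_cases hyU : y ∈ U
    · simp only [if_pos hyU]; exact hgc y ⟨hyU, hy⟩
    · simp only [if_neg hyU]; rfl
  exact ⟨_, fun y hy => hy.elim (hg.congr hU e1 y) ((hh.const_smul hc).congr hV e2 y)⟩

/-- Continuation of a flat section along a segment. -/
theorem exists_flatOn_convex {Ω : Set ℂ} {c y : ℂ} (hΩ : IsOpen Ω) (hc : StarConvex ℝ c Ω)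
    (hloc : ∀ x ∈ Ω, ∃ r > 0, ∃ h, FlatOn A L (ball x r) h)
    (hL : ∀ y ∈ Ω, ∀ v ∈ L y, v ≠ 0 → ∀ w ∈ L y, ∃ c : ℂ, w = c • v) (hy : y ∈ Ω) :
    ∃ V, IsOpen V ∧ Convex ℝ V ∧ V ⊆ Ω ∧ c ∈ V ∧ y ∈ V ∧ ∃ h, FlatOn A L V h := by
  let γ : ℝ →ᵃ[ℝ] ℂ := AffineMap.lineMap c y
  have hγΩ : γ '' Set.Icc 0 1 ⊆ Ω := by
    rw [← segment_eq_image_lineMap]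
    exact hc.segment_subset hy
  have hγc : Continuous γ := AffineMap.lineMap_continuous
  obtain ⟨δ, hδ, hball⟩ : ∃ δ > 0, ∀ x ∈ γ '' Set.Icc 0 1, ball x δ ⊆ Ω ∧
      ∃ h, FlatOn A L (ball x δ) h := by
    have hloc' (x : Ω) : ∃ r > 0, ball (x : ℂ) r ⊆ Ω ∧ ∃ h, FlatOn A L (ball (x : ℂ) r) h := by
      obtain ⟨r, hr, h, hh⟩ := hloc x x.2
      obtain ⟨r', hr', hr'Ω⟩ := Metric.isOpen_iff.mp hΩ x x.2
      exact ⟨min r r', lt_min hr hr', (ball_subset_ball (min_le_right _ _)).trans hr'Ω, h,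
        hh.mono (ball_subset_ball (min_le_left _ _))⟩
    choose r hr hrΩ h hh using hloc'
    obtain ⟨δ, hδ, hδ'⟩ := lebesgue_number_lemma_of_metric (isCompact_Icc.image hγc)
      (fun x : Ω => isOpen_ball (x := (x : ℂ)) (ε := r x))
      fun x hx => Set.mem_iUnion.mpr ⟨⟨x, hγΩ hx⟩, mem_ball_self (hr _)⟩
    refine ⟨δ, hδ, fun x hx => ?_⟩
    obtain ⟨i, hi⟩ := hδ' x hx
    exact ⟨hi.trans (hrΩ i), h i, (hh i).mono hi⟩
  have hthick {ε τ : ℝ} (hε : ε ≤ δ) (hτ : τ ≤ 1) : thickening ε (γ '' Set.Icc 0 τ) ⊆ Ω := by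
    intro w hw
    obtain ⟨x, hx, hwx⟩ := mem_thickening_iff.mp hw
    exact (hball x (Set.image_mono (Set.Icc_subset_Icc_right hτ) hx)).1
      (mem_ball.mpr (hwx.trans_le hε))
  have hconv (ε τ : ℝ) : Convex ℝ (thickening ε (γ '' Set.Icc 0 τ)) :=
    ((convex_Icc 0 τ).affine_image γ).thickening ε
  have hdist (s t : ℝ) : dist (γ s) (γ t) = dist s t * dist c y := dist_lineMap_lineMap c y s t
  have step {τ τ' : ℝ} (h0 : 0 ≤ τ) (hττ' : τ ≤ τ') (h1 : τ' ≤ 1)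
      (hd : (τ' - τ) * dist c y < δ / 2)
      (hP : ∃ ε > 0, ε ≤ δ ∧ ∃ h, FlatOn A L (thickening ε (γ '' Set.Icc 0 τ)) h) :
      ∃ ε > 0, ε ≤ δ ∧ ∃ h, FlatOn A L (thickening ε (γ '' Set.Icc 0 τ')) h := by
    obtain ⟨ε, hε, hεδ, h, hh⟩ := hP
    obtain ⟨-, k, hk⟩ := hball (γ τ') ⟨τ', ⟨h0.trans hττ', h1⟩, rfl⟩
    -- The neighbourhood of the traversed segment and the new ball are convex, so they meet in a
    -- connected set.
    obtain ⟨f, hf⟩ := hh.exists_union hk isOpen_thickening isOpen_ball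
      ((hconv ε τ).inter (convex_ball _ _)).isPreconnected
      fun x hx => hL x (hthick hεδ (hττ'.trans h1) hx)
    -- A point of the new thickening is within δ/2 of the segment, whose new part is within δ/2 of
    -- `γ τ'`; the ball of radius δ therefore covers it.
    refine ⟨min ε (δ / 2), lt_min hε (half_pos hδ), (min_le_left _ _).trans hεδ, f, hf.mono ?_⟩
    intro w hw
    obtain ⟨_, ⟨σ, hσ, rfl⟩, hwx⟩ := mem_thickening_iff.mp hw
    rcases le_total σ τ with hστ | hστ
    · exact Or.inl (mem_thickening_iff.mpr
        ⟨γ σ, ⟨σ, ⟨hσ.1, hστ⟩, rfl⟩, hwx.trans_le (min_le_left _ _)⟩)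
    · refine Or.inr (mem_ball.mpr ?_)
      have h2 : dist (γ σ) (γ τ') < δ / 2 := by
        rw [hdist]
        refine lt_of_le_of_lt (mul_le_mul_of_nonneg_right ?_ dist_nonneg) hd
        rw [dist_comm, Real.dist_eq, abs_of_nonneg (sub_nonneg.mpr hσ.2)]
        linarith
      have h3 := hwx.trans_le (min_le_right _ _)
      linarith [dist_triangle w (γ σ) (γ τ')]
  obtain ⟨N, hN⟩ := exists_nat_gt (dist c y / (δ / 2))
  have hN0 : (0 : ℝ) < N := lt_of_le_of_lt (by positivity) hN
  have hsmall : 1 / (N : ℝ) * dist c y < δ / 2 := by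
    rw [div_lt_iff₀ (half_pos hδ)] at hN
    rw [one_div_mul_eq_div, div_lt_iff₀ hN0, mul_comm]
    exact hN
  have hall (k : ℕ) (hk : k ≤ N) :
      ∃ ε > 0, ε ≤ δ ∧ ∃ h, FlatOn A L (thickening ε (γ '' Set.Icc 0 (k / N : ℝ))) h := by
    induction k with
    | zero =>
      obtain ⟨-, h, hh⟩ := hball (γ 0) ⟨0, by simp, rfl⟩
      refine ⟨δ, hδ, le_rfl, h, ?_⟩
      simpa using hh
    | succ k ih =>
      refine step (by positivity) (by gcongr; simp) ?_ ?_ (ih (by omega))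
      · rw [div_le_one hN0]; exact_mod_cast hk
      · rw [← sub_div]; push_cast; rwa [add_sub_cancel_left]
  obtain ⟨ε, hε, hεδ, h, hh⟩ := hall N le_rfl
  rw [div_self hN0.ne'] at hh
  have hsub := self_subset_thickening hε (γ '' Set.Icc 0 1)
  exact ⟨_, isOpen_thickening, hconv ε 1, hthick hεδ le_rfl,
    hsub ⟨0, by simp, AffineMap.lineMap_apply_zero c y⟩,
    hsub ⟨1, by simp, AffineMap.lineMap_apply_one c y⟩, h, hh⟩

/-- A line bundle with local flat sections has a flat section over a star-shaped open set. -/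
theorem exists_flatOn_starConvex {Ω : Set ℂ} {c : ℂ} (hΩ : IsOpen Ω) (hc : StarConvex ℝ c Ω)
    (hloc : ∀ x ∈ Ω, ∃ r > 0, ∃ h, FlatOn A L (ball x r) h)
    (hL : ∀ y ∈ Ω, ∀ v ∈ L y, v ≠ 0 → ∀ w ∈ L y, ∃ c : ℂ, w = c • v) :
    ∃ h, FlatOn A L Ω h := by
  rcases Ω.eq_empty_or_nonempty with rfl | hne
  · exact ⟨0, fun y hy => absurd hy (Set.notMem_empty y)⟩
  have hcΩ : c ∈ Ω := hc.mem hne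
  obtain ⟨r, hr, h₀, hh₀⟩ := hloc c hcΩ
  obtain ⟨-, hv, hv0⟩ := hh₀ c (mem_ball_self hr)
  -- Normalising every continuation by its value at the centre c makes any two agree on the convex
  -- intersection of their domains, so that they glue.
  have hex (y : ℂ) : ∃ V h, y ∈ Ω → IsOpen V ∧ Convex ℝ V ∧ V ⊆ Ω ∧ c ∈ V ∧ y ∈ V ∧
      FlatOn A L V h ∧ h c = h₀ c := by
    by_cases hy : y ∈ Ω
    · obtain ⟨V, h1, h2, h3, h4, h5, h, hh⟩ := exists_flatOn_convex hΩ hc hloc hL hy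
      obtain ⟨a, ha⟩ := hL c hcΩ _ (hh c h4).2.1 (hh c h4).2.2 _ hv
      have ha0 : a ≠ 0 := fun h => hv0 (by rw [ha, h, zero_smul])
      exact ⟨V, a • h, fun _ => ⟨h1, h2, h3, h4, h5, hh.const_smul ha0, ha.symm⟩⟩
    · exact ⟨∅, 0, fun h => absurd h hy⟩
  choose V h hVh using hex
  refine ⟨fun y => h y y, fun y₀ hy₀ => ?_⟩
  obtain ⟨o1, o2, o3, o4, o5, o6, o7⟩ := hVh y₀ hy₀
  refine o6.congr o1 (fun y hy => ?_) y₀ o5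
  obtain ⟨q1, q2, q3, q4, q5, q6, q7⟩ := hVh y (o3 hy)
  obtain ⟨a, -, ha⟩ := (q6.mono Set.inter_subset_left).exists_eq_smul
    (o6.mono (Set.inter_subset_right (s := V y))) (q1.inter o1) (q2.inter o2).isPreconnected
    fun x hx => hL x (o3 hx.2)
  have h1 := ha c ⟨q4, o4⟩
  rw [q7, o7] at h1
  have ha1 : a = 1 := by
    have : (1 - a) • h₀ c = 0 := by rw [sub_smul, one_smul, ← h1, sub_self]
    exact (sub_eq_zero.mp ((smul_eq_zero.mp this).resolve_right hv0)).symm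
  have := ha y ⟨q5, hy⟩
  rwa [ha1, one_smul] at this

end FlatSections

/-! ### Holonomy from the residue of the equation. -/

section Holonomy

open Complex

variable {E : Type*} [NormedAddCommGroup E] [NormedSpace ℂ E]

/-- Transport around a circle for an equation that is close to one with constant coefficients
`α + β P`, where `P` is idempotent. -/
theorem norm_transport_sub_le {P : E →L[ℂ] E} (hP : ∀ v, P (P v) = P v) {α : ℝ} {β : ℤ}
    {ρ : ℝ} (hρ0 : 0 ≤ ρ) (hρ : ρ ≤ 1) {φ R : ℝ → E}
    (hφ : ∀ θ ∈ Set.Icc 0 (2 * Real.pi), HasDerivAt φ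
      (I • ((α : ℂ) • φ θ + (β : ℂ) • P (φ θ) + R θ)) θ)
    (hR : ∀ θ ∈ Set.Icc 0 (2 * Real.pi), ‖R θ‖ ≤ ρ * ‖φ θ‖) :
    ‖cexp (-(2 * Real.pi * α * I)) • φ (2 * Real.pi) - φ 0‖ ≤
      (1 + 2 * ‖P‖) * Real.exp ((|α| + |(β : ℝ)| * ‖P‖ + 1) * (2 * Real.pi)) * (2 * Real.pi) *
        ‖φ 0‖ * ρ := by
  have hpi : 0 < 2 * Real.pi := Real.two_pi_pos
  set K := |α| + |(β : ℝ)| * ‖P‖ + 1 with hK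
  have hK0 : 0 ≤ K := by positivity
  -- Grönwall's inequality makes the error term small relative to `‖φ 0‖`.
  have hφb : ∀ θ ∈ Set.Icc 0 (2 * Real.pi), ‖φ θ‖ ≤ ‖φ 0‖ * Real.exp (K * (2 * Real.pi)) := by
    intro θ hθ
    have h := norm_le_gronwallBound_of_norm_deriv_right_le (f := φ) (δ := ‖φ 0‖) (K := K) (ε := 0)
      (fun t ht => (hφ t ht).continuousAt.continuousWithinAt)
      (fun t ht => (hφ t ⟨ht.1, ht.2.le⟩).hasDerivWithinAt) le_rfl (fun t ht => ?_) θ hθ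
    · rw [gronwallBound_ε0, sub_zero] at h
      refine h.trans (mul_le_mul_of_nonneg_left (Real.exp_le_exp.mpr ?_) (norm_nonneg _))
      exact mul_le_mul_of_nonneg_left hθ.2 hK0
    · rw [norm_smul, norm_I, one_mul, add_zero]
      refine (norm_add₃_le).trans ?_
      have h1 := P.le_opNorm (φ t)
      have h2 := hR t ⟨ht.1, ht.2.le⟩
      have h3 : ρ * ‖φ t‖ ≤ 1 * ‖φ t‖ := mul_le_mul_of_nonneg_right hρ (norm_nonneg _)
      rw [norm_smul, norm_smul, norm_real, Real.norm_eq_abs, norm_intCast]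
      have h4 := mul_le_mul_of_nonneg_left h1 (abs_nonneg (β : ℝ))
      rw [hK]
      linarith
  set e₁ : ℝ → ℂ := fun θ => cexp (-(θ * α * I)) with he₁
  set e₂ : ℝ → ℂ := fun θ => cexp (-(θ * β * I)) with he₂
  have hlin (γ : ℂ) (θ : ℝ) :
      HasDerivAt (fun θ : ℝ => cexp (-(θ * γ * I))) (-(γ * I) * cexp (-(θ * γ * I))) θ := by
    have h1 : HasDerivAt (fun θ : ℝ => (-(θ * γ * I) : ℂ)) (-(1 * γ * I)) θ :=
      ((((hasDerivAt_id θ).ofReal_comp).mul_const γ).mul_const I).neg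
    refine h1.cexp.congr_deriv ?_
    ring
  have hn (γ θ : ℝ) : ‖cexp (-(θ * γ * I))‖ = 1 := by
    have : (-(θ * γ * I) : ℂ) = ((-(θ * γ) : ℝ) : ℂ) * I := by push_cast; ring
    rw [this, norm_exp_ofReal_mul_I]
  have he₁n (θ : ℝ) : ‖e₁ θ‖ = 1 := hn α θ
  have he₂n (θ : ℝ) : ‖e₂ θ‖ = 1 := by
    have := hn β θ
    simpa [he₂] using this
  -- The integrating factor `exp(-iθ(α + βP))`: idempotence of P gives `exp(-iθβP) = 1 + (exp(-iθβ)
  -- - 1) P`. Only R survives in the derivative of u.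
  set u : ℝ → E := fun θ => e₁ θ • (φ θ + (e₂ θ - 1) • P (φ θ)) with hu
  have hu' : ∀ θ ∈ Set.Icc 0 (2 * Real.pi),
      HasDerivAt u ((e₁ θ * I) • (R θ + (e₂ θ - 1) • P (R θ))) θ := by
    intro θ hθ
    have h1 := hφ θ hθ
    have h2 : HasDerivAt (fun t => P (φ t))
        (P (I • ((α : ℂ) • φ θ + (β : ℂ) • P (φ θ) + R θ))) θ :=
      (P.restrictScalars ℝ).hasFDerivAt.comp_hasDerivAt θ h1
    have h3 := (hlin α θ).fun_smul (h1.fun_add (((hlin β θ).sub_const 1).fun_smul h2))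
    refine h3.congr_deriv ?_
    simp only [map_smul, map_add, hP, he₁, he₂]
    module
  have hbound : ∀ θ ∈ Set.Ico 0 (2 * Real.pi),
      ‖(e₁ θ * I) • (R θ + (e₂ θ - 1) • P (R θ))‖ ≤
        (1 + 2 * ‖P‖) * (ρ * (‖φ 0‖ * Real.exp (K * (2 * Real.pi)))) := by
    intro θ hθ
    have hθ' : θ ∈ Set.Icc 0 (2 * Real.pi) := ⟨hθ.1, hθ.2.le⟩
    rw [norm_smul, norm_mul, he₁n, norm_I, one_mul, one_mul]
    have h1 : ‖R θ‖ ≤ ρ * (‖φ 0‖ * Real.exp (K * (2 * Real.pi))) :=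
      (hR θ hθ').trans (mul_le_mul_of_nonneg_left (hφb θ hθ') hρ0)
    have h2 : ‖e₂ θ - 1‖ ≤ 2 := (norm_sub_le _ _).trans (by rw [he₂n, norm_one]; norm_num)
    calc ‖R θ + (e₂ θ - 1) • P (R θ)‖ ≤ ‖R θ‖ + 2 * (‖P‖ * ‖R θ‖) := by
          refine (norm_add_le _ _).trans (add_le_add_right ?_ _)
          rw [norm_smul]
          exact mul_le_mul h2 (P.le_opNorm _) (norm_nonneg _) zero_le_two
      _ = (1 + 2 * ‖P‖) * ‖R θ‖ := by ring
      _ ≤ _ := mul_le_mul_of_nonneg_left h1 (by positivity)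
  have hfin := norm_image_sub_le_of_norm_deriv_right_le_segment (f := u)
    (fun t ht => (hu' t ht).continuousAt.continuousWithinAt)
    (fun t ht => (hu' t ⟨ht.1, ht.2.le⟩).hasDerivWithinAt) hbound (2 * Real.pi) ⟨hpi.le, le_rfl⟩
  have hu0 : u 0 = φ 0 := by simp [hu, he₁, he₂]
  have hu1 : u (2 * Real.pi) = cexp (-(2 * Real.pi * α * I)) • φ (2 * Real.pi) := by
    -- Integrality of β removes P after a full turn, so the transport is nearly scalar whatever line
    -- is transported.
    have h2 : e₂ (2 * Real.pi) = 1 := by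
      rw [he₂]
      have : (-(((2 * Real.pi : ℝ) : ℂ) * β * I)) = ((-β : ℤ) : ℂ) * (2 * Real.pi * I) := by
        push_cast; ring
      simp only [this]
      exact exp_int_mul_two_pi_mul_I _
    simp only [hu, h2, sub_self, zero_smul, add_zero, he₁]
    push_cast
    rfl
  rw [hu0, hu1, sub_zero] at hfin
  refine hfin.trans (le_of_eq ?_)
  ring

variable {A : ℂ → E →L[ℂ] E} {L : ℂ → Submodule ℂ E} {U V : Set ℂ} {g h : ℂ → E}

/-- The holonomy of a flat section around circles on which the equation approaches an equation with
constant coefficients. The section `h` is defined off the ray to the right of the centre, its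
continuation `g` off the ray to the left. -/
theorem holonomy_eq {c κ : ℂ} {P : E →L[ℂ] E} (hP : ∀ v, P (P v) = P v) {α : ℝ} {β : ℤ}
    (hh : FlatOn A L U h) (hg : FlatOn A L V g)
    (hup : ∀ y, c.im < y.im → h y = g y) (hlow : ∀ y, y.im < c.im → h y = κ • g y)
    (happrox : ∀ ε > 0, ∃ r > 0, ∀ w : ℂ, ‖w‖ = r → (-w ∈ slitPlane → c + w ∈ U) ∧
      (w ∈ slitPlane → c + w ∈ V) ∧ ∀ v ∈ L (c + w),
        ‖w • A (c + w) v - ((α : ℂ) • v + (β : ℂ) • P v)‖ ≤ ε * ‖v‖) :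
    κ = cexp (2 * Real.pi * α * I) := by
  have hpi := Real.pi_pos
  set C := (1 + 2 * ‖P‖) * Real.exp ((|α| + |(β : ℝ)| * ‖P‖ + 1) * (2 * Real.pi)) *
    (2 * Real.pi) with hC
  have hC0 : 0 < C := by positivity
  -- The number κ does not depend on the circle, and C does not depend on ε; hence the error must
  -- vanish.
  have main : ∀ ε > 0, ε ≤ 1 → ‖cexp (-(2 * Real.pi * α * I)) * κ - 1‖ ≤ C * ε := by
    intro ε hε hε1
    obtain ⟨r, hr, hw⟩ := happrox ε hε
    set w : ℝ → ℂ := fun θ => r * cexp (θ * I) with hwdef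
    have hwn (θ : ℝ) : ‖w θ‖ = r := by
      simp [hwdef, norm_exp_ofReal_mul_I, abs_of_pos hr]
    have hwre (θ : ℝ) : (w θ).re = r * Real.cos θ := by
      simp [hwdef, exp_ofReal_mul_I_re, exp_ofReal_mul_I_im]
    have hwim (θ : ℝ) : (w θ).im = r * Real.sin θ := by
      simp [hwdef, exp_ofReal_mul_I_re, exp_ofReal_mul_I_im]
    have hwd (θ : ℝ) : HasDerivAt (fun θ => c + w θ) (I * w θ) θ := by
      have h1 : HasDerivAt (fun θ : ℝ => (θ * I : ℂ)) (1 * I) θ :=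
        ((hasDerivAt_id θ).ofReal_comp).mul_const I
      refine ((h1.cexp.const_mul (r : ℂ)).const_add c).congr_deriv ?_
      simp only [hwdef]; ring
    have hwU {θ : ℝ} (hθ : θ ∈ Set.Ioo 0 (2 * Real.pi)) : c + w θ ∈ U := by
      refine (hw _ (hwn θ)).1 ?_
      rw [mem_slitPlane_iff, neg_re, neg_im, hwre, hwim]
      by_cases hs : Real.sin θ = 0
      · left
        have : θ = Real.pi := by
          rcases lt_trichotomy θ Real.pi with h | h | h
          · exact absurd hs (Real.sin_pos_of_pos_of_lt_pi hθ.1 h).ne'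
          · exact h
          · have := Real.sin_neg_of_neg_of_neg_pi_lt (x := θ - 2 * Real.pi)
              (by linarith [hθ.2]) (by linarith)
            rw [Real.sin_sub_two_pi] at this
            exact absurd hs this.ne
        rw [this, Real.cos_pi]
        linarith
      · right
        exact neg_ne_zero.mpr (mul_ne_zero hr.ne' hs)
    have hwV {θ : ℝ} (hθ : 0 < Real.cos θ) : c + w θ ∈ V := by
      refine (hw _ (hwn θ)).2.1 ?_
      rw [mem_slitPlane_iff, hwre]
      exact Or.inl (mul_pos hr hθ)
    -- One continuous branch along the circle: g at the start, h across the ray to the left, and κ g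
    -- on return. Thus `φ (2π) = κ • φ 0`.
    set φ : ℝ → E := fun θ => if θ < Real.pi / 2 then g (c + w θ) else
      if θ < 3 * Real.pi / 2 then h (c + w θ) else κ • g (c + w θ) with hφ
    have im_add (θ : ℝ) : (c + w θ).im = c.im + r * Real.sin θ := by rw [add_im, hwim]
    have hφ1 {θ : ℝ} (hθ : θ ∈ Set.Ioo 0 (2 * Real.pi)) : φ θ = h (c + w θ) := by
      simp only [hφ]
      split_ifs with h1 h2
      · refine (hup _ ?_).symm
        rw [im_add]
        have := mul_pos hr (Real.sin_pos_of_pos_of_lt_pi hθ.1 (by linarith))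
        linarith
      · rfl
      · refine (hlow _ ?_).symm
        rw [im_add]
        have h3 := Real.sin_neg_of_neg_of_neg_pi_lt (x := θ - 2 * Real.pi)
          (by linarith [hθ.2]) (by linarith)
        rw [Real.sin_sub_two_pi] at h3
        have := mul_neg_of_pos_of_neg hr h3
        linarith
    have hφ0 {θ : ℝ} (hθ : θ < Real.pi / 2) : φ θ = g (c + w θ) := by simp only [hφ, if_pos hθ]
    have hφ2 {θ : ℝ} (hθ : 3 * Real.pi / 2 < θ) : φ θ = κ • g (c + w θ) := by
      simp only [hφ]
      rw [if_neg (by linarith), if_neg (by linarith)]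
    set R : ℝ → E := fun θ => w θ • A (c + w θ) (φ θ) - ((α : ℂ) • φ θ + (β : ℂ) • P (φ θ)) with hR
    have hcase : ∀ θ ∈ Set.Icc 0 (2 * Real.pi),
        HasDerivAt φ (I • (w θ • A (c + w θ) (φ θ))) θ ∧ φ θ ∈ L (c + w θ) := by
      intro θ hθ
      have hcomp {k : ℂ → E} {y' : E} (hk : HasDerivAt k y' (c + w θ)) :
          HasDerivAt (fun t => k (c + w t)) (I • (w θ • y')) θ := by
        refine (hk.scomp θ (hwd θ)).congr_deriv ?_
        rw [mul_smul]
      rcases hθ.1.eq_or_lt with rfl | h0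
      · have hm := hg _ (hwV (θ := 0) (by simp))
        have e0 := hφ0 (θ := 0) (by linarith)
        rw [e0]
        exact ⟨(hcomp hm.1).congr_of_eventuallyEq
          (Filter.eventually_of_mem (Iio_mem_nhds (by linarith : (0 : ℝ) < Real.pi / 2))
            fun t ht => hφ0 ht), hm.2.1⟩
      rcases hθ.2.eq_or_lt with rfl | h1
      · have hm := hg _ (hwV (θ := 2 * Real.pi) (by simp))
        have e0 := hφ2 (θ := 2 * Real.pi) (by linarith)
        rw [e0, map_smul, smul_comm (w _) κ, smul_comm I κ]
        exact ⟨((hcomp hm.1).const_smul κ).congr_of_eventuallyEq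
          (Filter.eventually_of_mem (Ioi_mem_nhds (by linarith : 3 * Real.pi / 2 < 2 * Real.pi))
            fun t ht => hφ2 ht), Submodule.smul_mem _ _ hm.2.1⟩
      · have hm := hh _ (hwU ⟨h0, h1⟩)
        rw [hφ1 ⟨h0, h1⟩]
        exact ⟨(hcomp hm.1).congr_of_eventuallyEq
          (Filter.eventually_of_mem (Ioo_mem_nhds h0 h1) fun t ht => hφ1 ht), hm.2.1⟩
    have h1 := norm_transport_sub_le hP (α := α) (β := β) hε.le hε1 (φ := φ) (R := R)
      (fun θ hθ => (hcase θ hθ).1.congr_deriv (by simp only [hR]; rw [add_sub_cancel]))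
      (fun θ hθ => (hw _ (hwn θ)).2.2 _ (hcase θ hθ).2)
    have e0 := hφ0 (θ := 0) (by linarith)
    have e2 := hφ2 (θ := 2 * Real.pi) (by linarith)
    have ew : w (2 * Real.pi) = w 0 := by
      simp only [hwdef]
      push_cast
      rw [exp_two_pi_mul_I]
      simp
    rw [e2, ew, ← e0, smul_smul] at h1
    have hne : φ 0 ≠ 0 := by
      rw [e0]
      exact (hg _ (hwV (θ := 0) (by simp))).2.2
    have h2 : (cexp (-(2 * Real.pi * α * I)) * κ) • φ 0 - φ 0 =
        (cexp (-(2 * Real.pi * α * I)) * κ - 1) • φ 0 := by rw [sub_smul, one_smul]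
    rw [h2, norm_smul, ← hC, mul_right_comm C] at h1
    exact le_of_mul_le_mul_right h1 (norm_pos_iff.mpr hne)
  have hzero : ‖cexp (-(2 * Real.pi * α * I)) * κ - 1‖ ≤ 0 := by
    refine le_of_forall_pos_le_add fun ε hε => ?_
    rw [zero_add]
    refine (main (min (ε / C) 1) (lt_min (by positivity) one_pos) (min_le_right _ _)).trans ?_
    refine (mul_le_mul_of_nonneg_left (min_le_left _ _) hC0.le).trans (le_of_eq ?_)
    field_simp
  have h1 := sub_eq_zero.mp (norm_le_zero_iff.mp hzero)
  rw [exp_neg, inv_mul_eq_iff_eq_mul₀ (exp_ne_zero _), mul_one] at h1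
  exact h1

end Holonomy

/-! ### Nonexistence of an invariant line bundle over ℂ. -/

section ComplexConnection

open Complex Metric

/-- The point `(0, 1, y)`. -/
def slicePoint (y : ℂ) : Fin 3 → ℂ := ![0, 1, y]

theorem slicePoint_mem {y : ℂ} (h0 : y ≠ 0) (h1 : y ≠ 1) : slicePoint y ∈ offDiagonals ℂ := by
  intro i j hij
  fin_cases i <;> fin_cases j <;> simp_all [slicePoint, eq_comm]

theorem hasDerivAt_slicePoint (y : ℂ) : HasDerivAt slicePoint (Pi.single 2 1) y := by
  refine hasDerivAt_pi.mpr fun i => ?_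
  fin_cases i
  · exact hasDerivAt_const y (0 : ℂ)
  · exact hasDerivAt_const y (1 : ℂ)
  · exact hasDerivAt_id y

/-- The operator `Ω_{ij}`. -/
noncomputable def omegaOp (i j : Fin 3) : (Fin 3 → ℂ) →L[ℂ] (Fin 3 → ℂ) :=
  (ContinuousLinearMap.proj (R := ℂ) (φ := fun _ : Fin 3 => ℂ) j - ContinuousLinearMap.proj i).smulRight
    (Pi.single i 1 - Pi.single j 1)

theorem omegaOp_apply (i j : Fin 3) (v : Fin 3 → ℂ) :
    omegaOp i j v = (v j - v i) • (Pi.single i 1 - Pi.single j 1) := rfl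

theorem omegaOp_omegaOp {i j : Fin 3} (hij : i ≠ j) (v : Fin 3 → ℂ) :
    omegaOp i j (omegaOp i j v) = (-2 : ℂ) • omegaOp i j v := by
  simp only [omegaOp_apply, Pi.smul_apply, Pi.sub_apply, Pi.single_eq_same,
    Pi.single_eq_of_ne hij, Pi.single_eq_of_ne hij.symm, smul_eq_mul, smul_smul]
  congr 1
  ring

/-- The operator `H_3(0, 1, y)`. -/
noncomputable def sliceOp (y : ℂ) : (Fin 3 → ℂ) →L[ℂ] (Fin 3 → ℂ) :=
  (2⁻¹ * y⁻¹) • omegaOp 2 0 + (2⁻¹ * (y - 1)⁻¹) • omegaOp 2 1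

theorem sliceOp_apply (y : ℂ) (v : Fin 3 → ℂ) :
    sliceOp y v = (2⁻¹ * y⁻¹) • omegaOp 2 0 v + (2⁻¹ * (y - 1)⁻¹) • omegaOp 2 1 v := rfl

theorem H_mulVec_slicePoint (y : ℂ) (v : Fin 3 → ℂ) :
    Matrix.mulVec (H 2 (slicePoint y)) v = sliceOp y v := by
  have h : (univ.erase 2 : Finset (Fin 3)) = {0, 1} := by decide
  rw [H_mulVec, h, sum_pair (by decide), sliceOp_apply, omegaOp_apply, omegaOp_apply]
  simp only [slicePoint, Matrix.cons_val, sub_zero, smul_add, smul_smul]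
  congr 2 <;> ring

variable {M : (Fin 3 → ℂ) → Submodule ℂ (Fin 3 → ℂ)}

theorem exists_smul_of_isAnalyticLineSubbundle {D : Set (Fin 3 → ℂ)}
    (hM : IsAnalyticLineSubbundle D M) {z : Fin 3 → ℂ} (hz : z ∈ D) {v w : Fin 3 → ℂ}
    (hv : v ∈ M z) (hv0 : v ≠ 0) (hw : w ∈ M z) : ∃ c : ℂ, w = c • v := by
  obtain ⟨U, -, hzU, -, e, -, he⟩ := hM z hz
  rw [(he z hzU).2.2] at hv hw
  obtain ⟨a, rfl⟩ := Submodule.mem_span_singleton.mp hv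
  obtain ⟨b, rfl⟩ := Submodule.mem_span_singleton.mp hw
  have ha : a ≠ 0 := fun h => hv0 (by rw [h, zero_smul])
  exact ⟨b * a⁻¹, by rw [smul_smul, inv_mul_cancel_right₀ ha]⟩

theorem le_W_of_isAnalyticLineSubbundle {D : Set (Fin 3 → ℂ)}
    (hM : IsAnalyticLineSubbundle D M) {z : Fin 3 → ℂ} (hz : z ∈ D) : M z ≤ W ℂ := by
  obtain ⟨U, -, hzU, -, e, -, he⟩ := hM z hz
  rw [(he z hzU).2.2, Submodule.span_singleton_le_iff_mem]
  exact (he z hzU).1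

/-- Local flat sections of an invariant line bundle over the slice `(0, 1, y)`. -/
theorem exists_flatOn_ball (hM : IsAnalyticLineSubbundle (offDiagonals ℂ) M)
    (hinv : IsKZInvariant (offDiagonals ℂ) M) {y₀ : ℂ} (h0 : y₀ ≠ 0) (h1 : y₀ ≠ 1) :
    ∃ r > 0, ∃ h, FlatOn sliceOp (fun y => M (slicePoint y)) (ball y₀ r) h := by
  obtain ⟨U, hU, hyU, hUD, e, hean, he⟩ := hM _ (slicePoint_mem h0 h1)
  have hsec : IsAnalyticSection M U e :=
    ⟨hean, fun z hz => by rw [(he z hz).2.2]; exact Submodule.mem_span_singleton_self _⟩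
  obtain ⟨s', ⟨hs'an, hs'M⟩, hs'⟩ := hinv U hU hUD e hsec 2
  have hcont : Continuous slicePoint :=
    continuous_iff_continuousAt.mpr fun y => (hasDerivAt_slicePoint y).continuousAt
  obtain ⟨i, hi⟩ := Function.ne_iff.mp (he _ hyU).2.1
  have hderiv (y : ℂ) (hy : slicePoint y ∈ U) :
      HasDerivAt (fun y => e (slicePoint y)) (sliceOp y (e (slicePoint y)) + s' (slicePoint y)) y := by
    refine ((hean _ hy).differentiableAt.hasFDerivAt.comp_hasDerivAt y
      (hasDerivAt_slicePoint y)).congr_deriv ?_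
    rw [hs' _ ⟨hy, hUD hy⟩, nabla, H_mulVec_slicePoint]
    abel
  have hs'd (y : ℂ) (hy : slicePoint y ∈ U) :
      DifferentiableAt ℂ (fun y => s' (slicePoint y)) y :=
    ((hs'an _ hy).differentiableAt.hasFDerivAt.comp_hasDerivAt y
      (hasDerivAt_slicePoint y)).differentiableAt
  have hnear : ∀ᶠ y in nhds y₀, slicePoint y ∈ U ∧ e (slicePoint y) i ≠ 0 := by
    refine (hcont.continuousAt.eventually (hU.mem_nhds hyU)).and ?_
    exact ((continuousAt_pi.mp (hderiv y₀ hyU).continuousAt) i).eventually_ne hi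
  obtain ⟨r, hr, hball⟩ := Metric.eventually_nhds_iff_ball.mp hnear
  -- Invariance gives `∇_3 e = μ e` with μ this quotient; multiplying e by `exp(-G)`, where G is a
  -- primitive of μ, makes it flat.
  have hμd : DifferentiableOn ℂ (fun y => s' (slicePoint y) i / e (slicePoint y) i) (ball y₀ r) :=
    fun y hy => ((differentiableAt_pi.mp (hs'd y (hball y hy).1) i).fun_div
      (differentiableAt_pi.mp (hderiv y (hball y hy).1).differentiableAt i)
      (hball y hy).2).differentiableWithinAt
  obtain ⟨G, hG⟩ := hμd.isExactOn_ball
  refine ⟨r, hr, fun y => cexp (-G y) • e (slicePoint y), fun y hy => ?_⟩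
  obtain ⟨hyU, hyi⟩ := hball y hy
  refine ⟨?_, Submodule.smul_mem _ _ (hsec.2 _ hyU), smul_ne_zero (exp_ne_zero _) (he _ hyU).2.1⟩
  have hs : s' (slicePoint y) = (s' (slicePoint y) i / e (slicePoint y) i) • e (slicePoint y) := by
    have hm := hs'M _ hyU
    rw [(he _ hyU).2.2] at hm
    obtain ⟨a, ha⟩ := Submodule.mem_span_singleton.mp hm
    rw [← ha, Pi.smul_apply, smul_eq_mul, mul_div_cancel_right₀ _ hyi]
  refine ((hG y hy).fun_neg.cexp.fun_smul (hderiv y hyU)).congr_deriv ?_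
  nth_rewrite 1 [hs]
  rw [map_smul]
  module

/-- The affine map sends c to a positive real, about which the slit plane is star-shaped. -/
theorem starConvex_preimage_slitPlane {a b c : ℂ} {x : ℝ} (hx : 0 < x) (hc : a * c + b = x) :
    StarConvex ℝ c {y : ℂ | a * y + b ∈ slitPlane} := by
  intro y hy s t hs ht hst
  have h := starConvex_ofReal_slitPlane hx hy hs ht hst
  have hst' : (s : ℂ) + t = 1 := by exact_mod_cast hst
  have e : a * (s • c + t • y) + b = s • (x : ℂ) + t • (a * y + b) := by
    rw [← hc]
    simp only [real_smul]
    linear_combination -b * hst'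
  change a * (s • c + t • y) + b ∈ slitPlane
  rw [e]
  exact h

theorem isOpen_preimage_slitPlane (a b : ℂ) : IsOpen {y : ℂ | a * y + b ∈ slitPlane} :=
  isOpen_slitPlane.preimage (by fun_prop)

theorem norm_sub_le_of_eq_smul {ι : Type*} [NormedAddCommGroup ι] [NormedSpace ℂ ι]
    {S : ι →L[ℂ] ι} {k : ℂ} {ε : ℝ} {a b v : ι} (h : a - b = k • S v) (hk : ‖k‖ * ‖S‖ ≤ ε) :
    ‖a - b‖ ≤ ε * ‖v‖ := by
  rw [h, norm_smul]
  calc ‖k‖ * ‖S v‖ ≤ ‖k‖ * (‖S‖ * ‖v‖) :=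
        mul_le_mul_of_nonneg_left (S.le_opNorm v) (norm_nonneg _)
    _ = ‖k‖ * ‖S‖ * ‖v‖ := (mul_assoc _ _ _).symm
    _ ≤ _ := mul_le_mul_of_nonneg_right hk (norm_nonneg _)

theorem norm_half_mul_inv_le {u : ℂ} {m : ℝ} (hm : 0 < m) (hu : m ≤ 2 * ‖u‖) :
    ‖2⁻¹ * u⁻¹‖ ≤ m⁻¹ := by
  rw [← mul_inv, norm_inv, norm_mul, norm_ofNat]
  exact inv_anti₀ hm hu

theorem exists_small_radius {ε C : ℝ} (hε : 0 < ε) (hC : 0 ≤ C) :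
    ∃ r > 0, r ≤ 1 / 2 ∧ r * C ≤ ε := by
  refine ⟨min (1 / 2) (ε / (C + 1)), by positivity, min_le_left _ _, ?_⟩
  calc min (1 / 2) (ε / (C + 1)) * C ≤ ε / (C + 1) * (C + 1) := by
        gcongr
        · exact min_le_right _ _
        · linarith
    _ = ε := by field_simp

theorem one_sub_mem_slitPlane {w : ℂ} (hw : ‖w‖ ≤ 1 / 2) : 1 - w ∈ slitPlane := by
  rw [mem_slitPlane_iff, sub_re, one_re]
  left
  linarith [(abs_le.mp ((abs_re_le_norm w).trans hw)).2]

/-- The residues `Ω/2` at 0 and 1 are thus minus a projection: α = 0 and β = -1 in `holonomy_eq`. -/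
theorem isIdempotent_omegaOp {i j : Fin 3} (hij : i ≠ j) (v : Fin 3 → ℂ) :
    (-(2⁻¹ : ℂ) • omegaOp i j) ((-(2⁻¹ : ℂ) • omegaOp i j) v) = (-(2⁻¹ : ℂ) • omegaOp i j) v := by
  simp only [_root_.smul_apply, map_smul, omegaOp_omegaOp hij, smul_smul]
  congr 1
  ring

/-- The KZ connection over `ℂ` has no invariant analytic line subbundle. -/
theorem not_exists_isKZInvariant_complex :
    ¬ ∃ M : (Fin 3 → ℂ) → Submodule ℂ (Fin 3 → ℂ),
      IsAnalyticLineSubbundle (offDiagonals ℂ) M ∧ IsKZInvariant (offDiagonals ℂ) M := by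
  rintro ⟨M, hM, hinv⟩
  set L : ℂ → Submodule ℂ (Fin 3 → ℂ) := fun y => M (slicePoint y) with hLdef
  -- Three star-shaped domains, each containing both open half-planes and exactly one of the real
  -- intervals (-∞, 0), (0, 1), (1, ∞).
  set Ω₀ : Set ℂ := {y | -1 * y + 0 ∈ slitPlane} with hΩ₀
  set Ω₁ : Set ℂ := {y | 1 * y + 0 ∈ slitPlane} ∩ {y | -1 * y + 1 ∈ slitPlane} with hΩ₁
  set Ω₂ : Set ℂ := {y | 1 * y + -1 ∈ slitPlane} with hΩ₂
  have sub₀ (y) (hy : y ∈ Ω₀) : y ≠ 0 ∧ y ≠ 1 := by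
    constructor <;> rintro rfl <;> norm_num [hΩ₀, mem_slitPlane_iff] at hy
  have sub₁ (y) (hy : y ∈ Ω₁) : y ≠ 0 ∧ y ≠ 1 := by
    constructor <;> rintro rfl <;> norm_num [hΩ₁, mem_slitPlane_iff] at hy
  have sub₂ (y) (hy : y ∈ Ω₂) : y ≠ 0 ∧ y ≠ 1 := by
    constructor <;> rintro rfl <;> norm_num [hΩ₂, mem_slitPlane_iff] at hy
  have hline (y : ℂ) (hy : y ≠ 0 ∧ y ≠ 1) : ∀ v ∈ L y, v ≠ 0 → ∀ w ∈ L y, ∃ c : ℂ, w = c • v :=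
    fun v hv hv0 w hw =>
      exists_smul_of_isAnalyticLineSubbundle hM (slicePoint_mem hy.1 hy.2) hv hv0 hw
  have hex {Ω : Set ℂ} {c : ℂ} (ho : IsOpen Ω) (hc : StarConvex ℝ c Ω)
      (hs : ∀ y ∈ Ω, y ≠ 0 ∧ y ≠ 1) : ∃ h, FlatOn sliceOp L Ω h :=
    exists_flatOn_starConvex ho hc (fun x hx => exists_flatOn_ball hM hinv (hs x hx).1 (hs x hx).2)
      fun y hy => hline y (hs y hy)
  have o₀ : IsOpen Ω₀ := isOpen_preimage_slitPlane _ _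
  have o₁ : IsOpen Ω₁ := (isOpen_preimage_slitPlane _ _).inter (isOpen_preimage_slitPlane _ _)
  have o₂ : IsOpen Ω₂ := isOpen_preimage_slitPlane _ _
  obtain ⟨h₀, hh₀⟩ := hex o₀ (starConvex_preimage_slitPlane (c := -1) one_pos (by simp)) sub₀
  obtain ⟨h₁, hh₁⟩ := hex o₁ ((starConvex_preimage_slitPlane (c := 2⁻¹) (x := 2⁻¹) (by norm_num)
    (by simp)).inter (starConvex_preimage_slitPlane (x := 2⁻¹) (by norm_num)
    (by push_cast; norm_num))) sub₁
  obtain ⟨h₂, hh₂⟩ := hex o₂ (starConvex_preimage_slitPlane (c := 2) one_pos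
    (by push_cast; norm_num)) sub₂
  have im₀ {y : ℂ} (hy : y.im ≠ 0) : y ∈ Ω₀ := by simp [hΩ₀, mem_slitPlane_iff, hy]
  have im₁ {y : ℂ} (hy : y.im ≠ 0) : y ∈ Ω₁ := by simp [hΩ₁, mem_slitPlane_iff, hy]
  have im₂ {y : ℂ} (hy : y.im ≠ 0) : y ∈ Ω₂ := by simp [hΩ₂, mem_slitPlane_iff, hy]
  set Up : Set ℂ := {y | 0 < y.im}
  set Lo : Set ℂ := {y | y.im < 0}
  have hUp : IsOpen Up := isOpen_lt continuous_const continuous_im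
  have hLo : IsOpen Lo := isOpen_lt continuous_im continuous_const
  -- Sections are rescaled to agree with `h₀` on the upper half-plane; the constant c on the lower
  -- one then records the holonomy.
  have cmp {Ω : Set ℂ} {h : ℂ → Fin 3 → ℂ} (hh : FlatOn sliceOp L Ω h)
      (im : ∀ {y : ℂ}, y.im ≠ 0 → y ∈ Ω) :
      ∃ k c : ℂ, k ≠ 0 ∧ c ≠ 0 ∧ (∀ y, 0 < y.im → (k • h) y = h₀ y) ∧
        ∀ y, y.im < 0 → (k • h) y = c • h₀ y := by
    obtain ⟨k, hk, hk'⟩ := (hh₀.mono fun y (hy : y ∈ Up) => im₀ (ne_of_gt hy)).exists_eq_smul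
      (hh.mono fun y (hy : y ∈ Up) => im (ne_of_gt hy)) hUp
      (convex_halfSpace_im_gt 0).isPreconnected fun y hy => hline y (sub₀ y (im₀ (ne_of_gt hy)))
    obtain ⟨c, hc, hc'⟩ := ((hh.const_smul hk).mono fun y (hy : y ∈ Lo) =>
      im (ne_of_lt hy)).exists_eq_smul
      (hh₀.mono fun y (hy : y ∈ Lo) => im₀ (ne_of_lt hy)) hLo
      (convex_halfSpace_im_lt 0).isPreconnected fun y hy => hline y (sub₀ y (im₀ (ne_of_lt hy)))
    exact ⟨k, c, hk, hc, fun y hy => (hk' y hy).symm, hc'⟩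
  obtain ⟨k₁, c₁, hk₁, hc₁, up₁, lo₁⟩ := cmp hh₁ im₁
  obtain ⟨k₂, c₂, hk₂, hc₂, up₂, lo₂⟩ := cmp hh₂ im₂
  have e₀ : c₁⁻¹ = cexp (2 * Real.pi * (0 : ℝ) * I) := by
    refine holonomy_eq (c := 0) (β := -1) (isIdempotent_omegaOp (i := 2) (j := 0) (by decide)) hh₀
      (hh₁.const_smul hk₁) (fun y hy => (up₁ y (by simpa using hy)).symm)
      (fun y hy => by rw [lo₁ y (by simpa using hy), inv_smul_smul₀ hc₁]) fun ε hε => ?_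
    obtain ⟨r, hr, hr1, hr2⟩ := exists_small_radius hε (norm_nonneg (omegaOp 2 1))
    refine ⟨r, hr, fun w hw => ⟨fun h => ?_, fun h => ⟨?_, ?_⟩, fun v _ => ?_⟩⟩
    · simpa [hΩ₀] using h
    · simpa using h
    · have := one_sub_mem_slitPlane (w := w) (by rw [hw]; exact hr1)
      simpa [neg_add_eq_sub] using this
    · have hw0 : w ≠ 0 := norm_pos_iff.mp (hw ▸ hr)
      refine norm_sub_le_of_eq_smul (S := omegaOp 2 1) (k := w * (2⁻¹ * (w - 1)⁻¹)) ?_ ?_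
      · have e : w * (2⁻¹ * w⁻¹) = 2⁻¹ := by field_simp
        rw [zero_add, sliceOp_apply, smul_add, smul_smul, e, _root_.smul_apply]
        push_cast
        module
      · have h1 : ‖2⁻¹ * (w - 1)⁻¹‖ ≤ 1⁻¹ := by
          refine norm_half_mul_inv_le one_pos ?_
          have := norm_sub_norm_le (1 : ℂ) w
          rw [norm_one, norm_sub_rev, hw] at this
          linarith
        rw [inv_one] at h1
        rw [norm_mul, hw]
        refine le_trans (mul_le_mul_of_nonneg_right ?_ (norm_nonneg _)) hr2
        exact mul_le_of_le_one_right hr.le h1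
  have e₁ : c₁ * c₂⁻¹ = cexp (2 * Real.pi * (0 : ℝ) * I) := by
    refine holonomy_eq (c := 1) (β := -1) (isIdempotent_omegaOp (i := 2) (j := 1) (by decide))
      (hh₁.const_smul hk₁) (hh₂.const_smul hk₂)
      (fun y hy => by rw [up₁ y (by simpa using hy), up₂ y (by simpa using hy)])
      (fun y hy => by
        rw [lo₁ y (by simpa using hy), lo₂ y (by simpa using hy), smul_smul,
          inv_mul_cancel_right₀ hc₂]) fun ε hε => ?_
    obtain ⟨r, hr, hr1, hr2⟩ := exists_small_radius hε (norm_nonneg (omegaOp 2 0))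
    refine ⟨r, hr, fun w hw => ⟨fun h => ⟨?_, ?_⟩, fun h => ?_, fun v _ => ?_⟩⟩
    · have := one_sub_mem_slitPlane (w := -w) (by rw [norm_neg, hw]; exact hr1)
      simpa using this
    · simpa using h
    · simpa [hΩ₂] using h
    · have hw0 : w ≠ 0 := norm_pos_iff.mp (hw ▸ hr)
      refine norm_sub_le_of_eq_smul (S := omegaOp 2 0) (k := w * (2⁻¹ * (1 + w)⁻¹)) ?_ ?_
      · have e : w * (2⁻¹ * w⁻¹) = 2⁻¹ := by field_simp
        rw [sliceOp_apply, add_sub_cancel_left, smul_add, smul_smul w (2⁻¹ * w⁻¹), e,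
          _root_.smul_apply]
        push_cast
        module
      · have h1 : ‖2⁻¹ * (1 + w)⁻¹‖ ≤ 1⁻¹ := by
          refine norm_half_mul_inv_le one_pos ?_
          have := norm_sub_norm_le (1 : ℂ) (-w)
          rw [norm_one, norm_neg, hw, sub_neg_eq_add] at this
          linarith
        rw [inv_one] at h1
        rw [norm_mul, hw]
        refine le_trans (mul_le_mul_of_nonneg_right ?_ (norm_nonneg _)) hr2
        exact mul_le_of_le_one_right hr.le h1
  have e₂ : c₂⁻¹ = cexp (2 * Real.pi * (-(3 / 2) : ℝ) * I) := by
    refine holonomy_eq (c := 0) (β := 1) (isIdempotent_omegaOp (i := 0) (j := 1) (by decide)) hh₀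
      (hh₂.const_smul hk₂) (fun y hy => (up₂ y (by simpa using hy)).symm)
      (fun y hy => by rw [lo₂ y (by simpa using hy), inv_smul_smul₀ hc₂]) fun ε hε => ?_
    have hC := norm_nonneg (omegaOp 2 1)
    -- On this large circle the deviation from the limit is `Ω_{21} / (2(w-1))`, of norm at most
    -- `‖Ω_{21}‖ / r ≤ ε`.
    set r : ℝ := 2 + ‖omegaOp 2 1‖ / ε with hr
    have hr2 : 2 ≤ r := by rw [hr]; linarith [div_nonneg hC hε.le]
    have hr0 : 0 < r := by linarith
    refine ⟨r, hr0, fun w hw => ⟨fun h => ?_, fun h => ?_, fun v hv => ?_⟩⟩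
    · simpa [hΩ₀] using h
    · simp only [hΩ₂, Set.mem_ofPred_eq, mem_slitPlane_iff] at h ⊢
      by_cases him : w.im = 0
      · left
        have hre : 0 < w.re := h.resolve_right (not_not.mpr him)
        have : ‖w‖ = w.re := by
          rw [← abs_re_eq_norm.mpr him, abs_of_pos hre]
        simp
        linarith
      · right; simpa using him
    · have hw0 : w ≠ 0 := norm_pos_iff.mp (hw ▸ hr0)
      have hw1 : w ≠ 1 := fun h => by rw [h, norm_one] at hw; linarith
      have hvW : ∑ i, v i = 0 := by
        rw [zero_add] at hv
        exact le_W_of_isAnalyticLineSubbundle hM (slicePoint_mem hw0 hw1) hv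
      rw [Fin.sum_univ_three] at hvW
      refine norm_sub_le_of_eq_smul (S := omegaOp 2 1) (k := 2⁻¹ * (w - 1)⁻¹) ?_ ?_
      · have e : w * (2⁻¹ * w⁻¹) = 2⁻¹ := by field_simp
        have e' : w * (2⁻¹ * (w - 1)⁻¹) = 2⁻¹ + 2⁻¹ * (w - 1)⁻¹ := by
          have := sub_ne_zero.mpr hw1
          field_simp
          ring
        rw [zero_add, sliceOp_apply, smul_add, smul_smul, smul_smul, e, e', _root_.smul_apply]
        -- On W the three operators `Ω_{ij}` add up to -3, so the residue at infinity is -3/2 plus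
        -- the projection `-Ω_{01}/2`.
        have key : (2⁻¹ : ℂ) • omegaOp 2 0 v + (2⁻¹ : ℂ) • omegaOp 2 1 v =
            (-(3 / 2) : ℂ) • v + -(2⁻¹ : ℂ) • omegaOp 0 1 v := by
          funext i
          simp only [omegaOp_apply, Pi.add_apply, Pi.smul_apply, Pi.sub_apply, smul_eq_mul,
            Pi.single_apply]
          fin_cases i <;> simp <;> linear_combination (1 / 2 : ℂ) * hvW
        push_cast
        rw [add_smul, ← add_assoc, key]
        module
      · have h1 : ‖2⁻¹ * (w - 1)⁻¹‖ ≤ r⁻¹ := by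
          refine norm_half_mul_inv_le hr0 ?_
          have := norm_sub_norm_le w (1 : ℂ)
          rw [norm_one, hw] at this
          linarith
        refine (mul_le_mul_of_nonneg_right h1 hC).trans ?_
        rw [inv_mul_le_iff₀ hr0, hr, add_mul, div_mul_cancel₀ _ hε.ne']
        linarith
  have h1 : cexp (2 * Real.pi * (0 : ℝ) * I) = 1 := by simp
  have h2 : cexp (2 * Real.pi * (-(3 / 2) : ℝ) * I) = -1 := by
    have : (2 * Real.pi * (-(3 / 2) : ℝ) * I : ℂ) =
        ((-2 : ℤ) : ℂ) * (2 * Real.pi * I) + Real.pi * I := by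
      push_cast; ring
    rw [this, exp_add, exp_int_mul_two_pi_mul_I, exp_pi_mul_I, one_mul]
  rw [h1] at e₀ e₁
  rw [h2] at e₂
  -- The holonomies 1 around 0 and 1 around 1 would have to multiply to -1.
  rw [inv_eq_one.mp e₀, one_mul, e₂] at e₁
  norm_num at e₁

end ComplexConnection

end PadicKZ

theorem mainTheorem12 (p : ℕ) [Fact p.Prime] (hp : p ≠ 2) :
    -- the limit defining `η` exists uniformly on the domain, and `η` is analytic:
    -- around each point it is given by a power series that converges on the residue polydisc
    (∀ s : ℕ, ∀ z ∈ PadicKZ.domain p, MvPolynomial.aeval z (PadicKZ.T p s) ≠ 0) ∧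
    TendstoUniformlyOn (PadicKZ.etaApprox p) (PadicKZ.eta p) Filter.atTop (PadicKZ.domain p) ∧
    (∀ a ∈ PadicKZ.domain p,
      ∃ q : FormalMultilinearSeries ℚ_[p] (Fin 3 → ℚ_[p]) (Fin 3 → ℚ_[p]),
        HasFPowerSeriesOnBall (PadicKZ.eta p) q a 1) ∧
    -- the lines spanned by `η` form an analytic line subbundle, invariant under the connection
    PadicKZ.IsAnalyticLineSubbundle (PadicKZ.domain p) (PadicKZ.lineL p) ∧
    PadicKZ.IsKZInvariant (PadicKZ.domain p) (PadicKZ.lineL p) ∧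
    -- the complex KZ connection has no invariant line subbundle
    ¬ ∃ M : (Fin 3 → ℂ) → Submodule ℂ (Fin 3 → ℂ),
        PadicKZ.IsAnalyticLineSubbundle (PadicKZ.offDiagonals ℂ) M ∧
        PadicKZ.IsKZInvariant (PadicKZ.offDiagonals ℂ) M :=
  ⟨fun s _ hz => PadicKZ.aeval_T_ne_zero hp s hz, PadicKZ.tendstoUniformlyOn_etaApprox hp,
    fun _ ha => PadicKZ.exists_hasFPowerSeriesOnBall_eta hp ha,
    PadicKZ.isAnalyticLineSubbundle_lineL hp, PadicKZ.isKZInvariant_lineL hp,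
    PadicKZ.not_exists_isKZInvariant_complex⟩
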